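/- Manifolds are smooth, Hausdorff and second countable. Let $M$ be an $n$-dimensional manifold with a coframing, i.e. a smooth $1$-form $\omega \in \Omega^1(M)\otimes V$ with values in an $n$-dimensional real vector space $V$ such that $\omega_m : T_mM \to V$ is a linear isomorphism for every $m \in M$. For a positive definite inner product $\langle\cdot,\cdot\rangle$ on $V$, the associated canonical metric is the Riemannian metric $\langle \omega_m u, \omega_m v\rangle$ on $M$. A curve $f:\mathbb{R}\to M$ is rectifiable if it is continuous and has finite length on every compact interval. Let $M_0$ and $M_1$ be manifolds with coframings $\omega_0\in\Omega^1(M_0)\otimes V_0$ and $\omega_1\in\Omega^1(M_1)\otimes V_1$ and let $A:V_0\to V_1$ be linear. A rectifiable curve $f_1:\mathbb{R}\to M_1$ is an $A$-development of a rectifiable curve $f_0:\mathbb{R}\to M_0$ if $f_1^*\omega_1 = A f_0^*\omega_0$ as $V_1$-valued measures on $\mathbb{R}$; equivalently, after some increasing homeomorphic change of the parameter that makes both curves locally Lipschitz, the identity $\omega_1(f_1') = A\,\omega_0(f_0')$ holds at almost every time. We say that curves $A$-develop from $M_0$ to $M_1$ if for every rectifiable curve $f_0:\mathbb{R}\to M_0$,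 every $t_0\in\mathbb{R}$ and every $m_1\in M_1$, there is an $A$-development $f_1:\mathbb{R}\to M_1$ of $f_0$ with $f_1(t_0)=m_1$. The following are equivalent: 1. some canonical metric on $M$ is complete; 2. every canonical metric on $M$ is complete; 3. curves develop to $M$ from $\mathbb{R}^n$ with its standard coframing $dx$, that is, they $A$-develop for some (equivalently, for every) linear isomorphism $A : \mathbb{R}^n \to V$; 4. curves $I$-develop to $M$ from some nonempty manifold $M_0$ with a coframing with values in $V$, where $I : V\to V$ is the identity; 5. curves $A$-develop to $M$ from any manifold $M_0$ (of any dimension) with any coframing $\omega_0\in\Omega^1(M_0)\otimes V_0$, for any linear map $A:V_0\to V$. -/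

import Mathlib

open Set Filter Topology MeasureTheory
open scoped Manifold ContDiff NNReal ENNReal

/-- A coframing of an `n`-dimensional smooth manifold `M`: a smooth `1`-form on `M` with values in
a vector space `V` of dimension `n`, which is a linear isomorphism `T_m M → V` at each point.
(The norm of `V` only serves to speak of smoothness; which norm it is does not matter.) -/
structure Coframing (n : ℕ) (M : Type*) [TopologicalSpace M]
    [ChartedSpace (EuclideanSpace ℝ (Fin n)) M] [IsManifold (𝓡 n) ∞ M]
    (V : Type*) [NormedAddCommGroup V] [NormedSpace ℝ V] where
  /-- The value of the `1`-form at a point. -/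
  form (m : M) : TangentSpace (𝓡 n) m →L[ℝ] V
  bijective (m : M) : Function.Bijective (form m)
  contMDiff : ContMDiff (𝓡 n) ((𝓡 n).prod 𝓘(ℝ, EuclideanSpace ℝ (Fin n) →L[ℝ] V)) ∞
    (fun m : M => Bundle.TotalSpace.mk' (EuclideanSpace ℝ (Fin n) →L[ℝ] V)
      (E := fun m : M => TangentSpace (𝓡 n) m →L[ℝ] Bundle.Trivial M V m) m (form m))
  finrank_eq : Module.finrank ℝ V = n

/-- The standard coframing `dx` of `ℝⁿ`, with values in `ℝⁿ`. -/
noncomputable def standardCoframing (n : ℕ) :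
    @Coframing n (EuclideanSpace ℝ (Fin n)) _ (chartedSpaceSelf _) instIsManifoldModelSpace
      (EuclideanSpace ℝ (Fin n)) _ _ where
  form _ := ContinuousLinearMap.id ℝ (EuclideanSpace ℝ (Fin n))
  bijective _ := Function.bijective_id
  contMDiff := by
    intro x
    refine (contMDiffAt_hom_bundle _).2 ⟨contMDiffAt_id, ?_⟩
    refine (contMDiffAt_const
      (c := ContinuousLinearMap.id ℝ (EuclideanSpace ℝ (Fin n)))).congr_of_eventuallyEq ?_
    refine Filter.Eventually.of_forall fun y => ?_
    ext1 v
    simp [ContinuousLinearMap.inCoordinates]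
    rfl
  finrank_eq := by simp

/-- A positive definite inner product on a real vector space. -/
structure IsInnerProduct {V : Type*} [NormedAddCommGroup V] [NormedSpace ℝ V]
    (B : V →L[ℝ] V →L[ℝ] ℝ) : Prop where
  symm (v w : V) : B v w = B w v
  pos (v : V) (hv : v ≠ 0) : 0 < B v v

theorem IsInnerProduct.isVonNBounded {E : Type*} [NormedAddCommGroup E]
    [NormedSpace ℝ E] [FiniteDimensional ℝ E] {B : E →L[ℝ] E →L[ℝ] ℝ} (hB : IsInnerProduct B) :
    Bornology.IsVonNBounded ℝ {v : E | B v v < 1} := by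
  rw [NormedSpace.isVonNBounded_iff, isBounded_iff_forall_norm_le]
  rcases subsingleton_or_nontrivial E with h | h
  · exact ⟨0, fun v _ => by simp [Subsingleton.elim v 0]⟩
  have hcont : Continuous fun v => B v v := B.continuous.clm_apply continuous_id
  obtain ⟨u, hu, hmin⟩ := (isCompact_sphere (0 : E) 1).exists_isMinOn
    (NormedSpace.sphere_nonempty.2 zero_le_one) hcont.continuousOn
  have hu1 : ‖u‖ = 1 := by simpa using hu
  have hc : 0 < B u u := hB.pos u (by rintro rfl; simp at hu1)
  refine ⟨1 + (B u u)⁻¹, fun v hv => ?_⟩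
  rcases eq_or_ne v 0 with rfl | hv0
  · simp; positivity
  have hn : 0 < ‖v‖ := norm_pos_iff.2 hv0
  have h1 : B u u ≤ B (‖v‖⁻¹ • v) (‖v‖⁻¹ • v) :=
    hmin (by simp [norm_smul, hn.ne'])
  simp only [map_smul, smul_apply, smul_eq_mul] at h1
  have h2 : B u u * ‖v‖ ^ 2 ≤ B v v := by
    have := mul_le_mul_of_nonneg_right h1 (sq_nonneg ‖v‖)
    calc _ ≤ _ := this
      _ = B v v := by field_simp
  have h3 : B v v < 1 := hv
  have h4 : ‖v‖ ^ 2 ≤ (B u u)⁻¹ := by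
    rw [← one_div, le_div_iff₀ hc]
    linarith
  have : 0 < (B u u)⁻¹ := by positivity
  nlinarith

theorem IsInnerProduct.bilinearComp {E V : Type*} [NormedAddCommGroup E] [NormedSpace ℝ E]
    [NormedAddCommGroup V] [NormedSpace ℝ V] {B : V →L[ℝ] V →L[ℝ] ℝ} (hB : IsInnerProduct B)
    {L : E →L[ℝ] V} (hL : Function.Injective L) : IsInnerProduct (B.bilinearComp L L) :=
  ⟨fun v w => hB.symm (L v) (L w),
    fun v hv => hB.pos (L v) fun h => hv (hL (h.trans (map_zero L).symm))⟩

theorem contDiff_bilinearComp_self {E V : Type*} [NormedAddCommGroup E] [NormedSpace ℝ E]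
    [NormedAddCommGroup V] [NormedSpace ℝ V] (B : V →L[ℝ] V →L[ℝ] ℝ) :
    ContDiff ℝ ∞ fun L : E →L[ℝ] V => B.bilinearComp L L := by
  have h : ContDiff ℝ ∞ fun L : E →L[ℝ] V =>
      ((ContinuousLinearMap.compL ℝ E V ℝ).flip L).comp (B.comp L) :=
    ContDiff.clm_comp (ContinuousLinearMap.contDiff _) (contDiff_const.clm_comp contDiff_id)
  exact h

theorem IsInnerProduct.isVonNBounded_comp {E V : Type*} [NormedAddCommGroup E] [NormedSpace ℝ E]
    [FiniteDimensional ℝ E]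
    [NormedAddCommGroup V] [NormedSpace ℝ V] {B : V →L[ℝ] V →L[ℝ] ℝ} (hB : IsInnerProduct B)
    {L : E →L[ℝ] V} (hL : Function.Injective L) :
    Bornology.IsVonNBounded ℝ {v : E | B (L v) (L v) < 1} :=
  (hB.bilinearComp hL).isVonNBounded

section Manifolds

variable {n : ℕ} {M : Type*} [TopologicalSpace M] [ChartedSpace (EuclideanSpace ℝ (Fin n)) M]

/-- The symmetric bilinear form `(u, v) ↦ B(θ_m u, θ_m v)` on the tangent space `T_m M`. -/
noncomputable def Coframing.pullbackForm [IsManifold (𝓡 n) ∞ M]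
    {V : Type*} [NormedAddCommGroup V] [NormedSpace ℝ V]
    (θ : Coframing n M V) (B : V →L[ℝ] V →L[ℝ] ℝ) (m : M) :
    TangentSpace (𝓡 n) m →L[ℝ] TangentSpace (𝓡 n) m →L[ℝ] ℝ :=
  let L : EuclideanSpace ℝ (Fin n) →L[ℝ] V := θ.form m
  (B.bilinearComp L L : EuclideanSpace ℝ (Fin n) →L[ℝ] EuclideanSpace ℝ (Fin n) →L[ℝ] ℝ)

theorem Coframing.pullbackForm_apply [IsManifold (𝓡 n) ∞ M]
    {V : Type*} [NormedAddCommGroup V] [NormedSpace ℝ V]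
    (θ : Coframing n M V) (B : V →L[ℝ] V →L[ℝ] ℝ) (m : M) (u v : TangentSpace (𝓡 n) m) :
    θ.pullbackForm B m u v = B (θ.form m u) (θ.form m v) := rfl

/-- The canonical metric of a coframing `θ` given by an inner product `B` on `V`: the Riemannian
metric for which each `θ_m : T_m M → V` is orthogonal, i.e. `g_m(u, v) = B(θ_m u, θ_m v)`. -/
noncomputable def Coframing.canonicalMetric [IsManifold (𝓡 n) ∞ M]
    {V : Type*} [NormedAddCommGroup V] [NormedSpace ℝ V]
    (θ : Coframing n M V) (B : V →L[ℝ] V →L[ℝ] ℝ) (hB : IsInnerProduct B) :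
    Bundle.ContMDiffRiemannianMetric (𝓡 n) ∞ (EuclideanSpace ℝ (Fin n))
      (fun m : M => TangentSpace (𝓡 n) m) where
  inner m := θ.pullbackForm B m
  symm m u v := hB.symm (θ.form m u) (θ.form m v)
  pos m v hv := hB.pos (θ.form m v)
    fun h => hv ((θ.bijective m).1 (h.trans (map_zero (θ.form m)).symm))
  isVonNBounded m := hB.isVonNBounded_comp (E := EuclideanSpace ℝ (Fin n)) (L := θ.form m)
      (θ.bijective m).1
  contMDiff := by
    intro x
    have h := ((contMDiffAt_hom_bundle _).1 (θ.contMDiff x)).2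
    refine (contMDiffAt_hom_bundle _).2 ⟨contMDiffAt_id, ?_⟩
    let Ω : M → EuclideanSpace ℝ (Fin n) →L[ℝ] V := fun y =>
      ContinuousLinearMap.inCoordinates (EuclideanSpace ℝ (Fin n)) (TangentSpace (𝓡 n)) V
        (Bundle.Trivial M V) x y x y (θ.form y)
    have hΩ : ContMDiffAt (𝓡 n) 𝓘(ℝ, EuclideanSpace ℝ (Fin n) →L[ℝ] V) ∞ Ω x := h
    have key := contDiff_bilinearComp_self (E := EuclideanSpace ℝ (Fin n)) B
    refine (key.contMDiff.contMDiffAt.comp x hΩ).congr_of_eventuallyEq ?_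
    filter_upwards [(trivializationAt (EuclideanSpace ℝ (Fin n)) (TangentSpace (𝓡 n))
      x).open_baseSet.mem_nhds (FiberBundle.mem_baseSet_trivializationAt' x)] with y hy
    ext v w
    refine (inCoordinates_apply_eq₂ (E₃ := Bundle.Trivial M ℝ) hy hy (Set.mem_univ _)).trans ?_
    simp only [Function.comp_apply, Ω, ContinuousLinearMap.inCoordinates]
    rw [Coframing.pullbackForm_apply, ← Bundle.Trivialization.symmL_apply (R := ℝ) _ hy v,
      ← Bundle.Trivialization.symmL_apply (R := ℝ) _ hy w]
    simp

open Bundle in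
/-- Completeness of a Riemannian metric `g` on `M`: Cauchy sequences converge, for the Riemannian
distance of `g` (the infimum of the lengths of `C¹` paths, which is `∞` between points of
different components). -/
def IsCompleteMetric [IsManifold (𝓡 n) ∞ M]
    (g : Bundle.ContMDiffRiemannianMetric (𝓡 n) ∞ (EuclideanSpace ℝ (Fin n))
      (fun m : M => TangentSpace (𝓡 n) m)) : Prop :=
  letI : RiemannianBundle (fun m : M => TangentSpace (𝓡 n) m) := ⟨g.toRiemannianMetric⟩
  ∀ x : ℕ → M,
    (∀ ε : ℝ≥0∞, 0 < ε → ∃ N, ∀ i ≥ N, ∀ j ≥ N, Manifold.riemannianEDist (𝓡 n) (x i) (x j) < ε) →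
    ∃ y : M, Tendsto (fun i => Manifold.riemannianEDist (𝓡 n) (x i) y) atTop (𝓝 0)

/-- A rectifiable curve: a continuous curve which has finite length on compact intervals.
As charts are locally bi-Lipschitz for any Riemannian metric, this means that it has locally
bounded variation in charts. -/
def IsRectifiable (n : ℕ) {M : Type*} [TopologicalSpace M]
    [ChartedSpace (EuclideanSpace ℝ (Fin n)) M] (f : ℝ → M) : Prop :=
  Continuous f ∧ ∀ t, ∃ s ∈ 𝓝 t, BoundedVariationOn (extChartAt (𝓡 n) (f t) ∘ f) s

/-- A locally Lipschitz curve. -/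
def IsLocallyLipschitz (n : ℕ) {M : Type*} [TopologicalSpace M]
    [ChartedSpace (EuclideanSpace ℝ (Fin n)) M] (f : ℝ → M) : Prop :=
  Continuous f ∧ ∀ t, ∃ K : ℝ≥0, ∃ s ∈ 𝓝 t, LipschitzOnWith K (extChartAt (𝓡 n) (f t) ∘ f) s

/-- The velocity of a curve at the time `s` (which is `0` by convention where the curve is not
differentiable; a locally Lipschitz curve is differentiable at almost every time). -/
noncomputable def velocity (n : ℕ) {M : Type*} [TopologicalSpace M]
    [ChartedSpace (EuclideanSpace ℝ (Fin n)) M] (f : ℝ → M) (s : ℝ) :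
    TangentSpace (𝓡 n) (f s) :=
  mfderiv 𝓘(ℝ, ℝ) (𝓡 n) f s (1 : ℝ)

end Manifolds

section Development

variable {n₀ n₁ : ℕ}
  {M₀ : Type*} [TopologicalSpace M₀] [ChartedSpace (EuclideanSpace ℝ (Fin n₀)) M₀]
  [IsManifold (𝓡 n₀) ∞ M₀] {V₀ : Type*} [NormedAddCommGroup V₀] [NormedSpace ℝ V₀]
  {M₁ : Type*} [TopologicalSpace M₁] [ChartedSpace (EuclideanSpace ℝ (Fin n₁)) M₁]
  [IsManifold (𝓡 n₁) ∞ M₁] {V₁ : Type*} [NormedAddCommGroup V₁] [NormedSpace ℝ V₁]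

/-- The rectifiable curve `f₁` is an `A`-development of the rectifiable curve `f₀`, i.e.
`f₁^* θ₁ = A f₀^* θ₀`. The pullback of a `1`-form by a rectifiable curve is the measure on `ℝ` whose
value on an interval is the integral of the form along that piece of the curve, and such integrals
are computed in any Lipschitz parametrization: some change of parameter `h` (an increasing
homeomorphism of `ℝ`) makes both curves locally Lipschitz, and then the equation holds between
velocities at almost every time. For smooth curves this says that
`θ₁(f₁'(t)) = A θ₀(f₀'(t))` for all `t`. -/
def IsDevelopment (θ₀ : Coframing n₀ M₀ V₀) (θ₁ : Coframing n₁ M₁ V₁) (A : V₀ →ₗ[ℝ] V₁)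
    (f₀ : ℝ → M₀) (f₁ : ℝ → M₁) : Prop :=
  ∃ h : ℝ ≃o ℝ, IsLocallyLipschitz n₀ (f₀ ∘ h) ∧ IsLocallyLipschitz n₁ (f₁ ∘ h) ∧
    ∀ᵐ s : ℝ, θ₁.form (f₁ (h s)) (velocity n₁ (f₁ ∘ h) s) =
      A (θ₀.form (f₀ (h s)) (velocity n₀ (f₀ ∘ h) s))

/-- Curves `A`-develop from `M₀` to `M₁`: every rectifiable curve `ℝ → M₀` has an `A`-development
`ℝ → M₁`, with any chosen value at any chosen time. -/
def CurvesDevelop (θ₀ : Coframing n₀ M₀ V₀) (θ₁ : Coframing n₁ M₁ V₁) (A : V₀ →ₗ[ℝ] V₁) : Prop :=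
  ∀ f₀ : ℝ → M₀, IsRectifiable n₀ f₀ → ∀ (t₀ : ℝ) (m₁ : M₁),
    ∃ f₁ : ℝ → M₁, IsRectifiable n₁ f₁ ∧ f₁ t₀ = m₁ ∧ IsDevelopment θ₀ θ₁ A f₀ f₁

end Development

/-! Developing a curve means solving `θ(g') = w` for a prescribed `w : ℝ → V`. In a chart this is
the Carathéodory equation `y' = F(y) w`, with `F y` inverse to the coframing and `w` locally bounded
and measurable. Picard iteration solves it for a time that depends only on a bound for `w` and is
uniform near each point (`Coframing.exists_hasVelocityOn_ball`); solutions are unique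
(`Coframing.HasVelocityOn.eqOn`). Rectifiable curves become locally Lipschitz after a change of
parameter, so only such equations arise.

Complete implies developing: a solution with `‖w‖ ≤ C` is Lipschitz for the canonical distance, with
a constant depending on `C` and the inner product alone. At a finite end of the maximal interval it
is therefore Cauchy, converges by completeness, and local existence near the limit continues it
(`Coframing.exists_hasVelocityOn_univ`).

Developing implies complete: a Cauchy sequence has a subsequence whose successive terms are joined
by paths of summable length. Run at bounded speed, these form one path of arbitrarily short total
duration. Its velocity, carried to `V₀` by the inverse of `A`, is the velocity of a curve in `M₀`,
by local existence alone. Developing that curve retraces the path by uniqueness, but is defined and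
continuous also at the final time, so the subsequence converges (`CurvesDevelop.isCompleteMetric`).

The inner product plays no role in the middle of this cycle, whence the equivalence of "some" and
"every". -/

theorem LipschitzOnWith.congr_eqOn {α β : Type*} [PseudoEMetricSpace α] [PseudoEMetricSpace β]
    {K : ℝ≥0} {f g : α → β} {s : Set α} (hf : LipschitzOnWith K f s) (h : EqOn g f s) :
    LipschitzOnWith K g s := fun x hx y hy => by
  rw [h hx, h hy]
  exact hf hx hy

/-! ### Lipschitz curves and the coframing in charts -/

section Charts

variable {n : ℕ} {M : Type*} [TopologicalSpace M] [ChartedSpace (EuclideanSpace ℝ (Fin n)) M]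

/-- A curve in a manifold which is Lipschitz near the time `t`. -/
def LipschitzNear (n : ℕ) {M : Type*} [TopologicalSpace M]
    [ChartedSpace (EuclideanSpace ℝ (Fin n)) M] (g : ℝ → M) (t : ℝ) : Prop :=
  ContinuousAt g t ∧ ∃ K : ℝ≥0, ∃ s ∈ 𝓝 t, LipschitzOnWith K (extChartAt (𝓡 n) (g t) ∘ g) s

theorem isLocallyLipschitz_iff {g : ℝ → M} :
    IsLocallyLipschitz n g ↔ ∀ t, LipschitzNear n g t :=
  ⟨fun h t => ⟨h.1.continuousAt, h.2 t⟩,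
    fun h => ⟨continuous_iff_continuousAt.2 fun t => (h t).1, fun t => (h t).2⟩⟩

/-- Transition maps are smooth, hence locally Lipschitz; so the choice of chart is immaterial. -/
theorem exists_lipschitzOnWith_extChartAt_comp [IsManifold (𝓡 n) ∞ M] {p q : M} {g : ℝ → M} {t : ℝ}
    (hg : ContinuousAt g t)
    (hp : g t ∈ (chartAt (EuclideanSpace ℝ (Fin n)) p).source)
    (hq : g t ∈ (chartAt (EuclideanSpace ℝ (Fin n)) q).source)
    (h : ∃ K : ℝ≥0, ∃ s ∈ 𝓝 t, LipschitzOnWith K (extChartAt (𝓡 n) p ∘ g) s) :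
    ∃ K : ℝ≥0, ∃ s ∈ 𝓝 t, LipschitzOnWith K (extChartAt (𝓡 n) q ∘ g) s := by
  obtain ⟨K, s, hs, hK⟩ := h
  have hp' : g t ∈ (extChartAt (𝓡 n) p).source := by rwa [extChartAt_source]
  have hc : ContDiffAt ℝ ∞ (extChartAt (𝓡 n) q ∘ (extChartAt (𝓡 n) p).symm)
      (extChartAt (𝓡 n) p (g t)) := by
    have := contDiffWithinAt_ext_coord_change (I := 𝓡 n) (n := ∞) q p
      (y := extChartAt (𝓡 n) p (g t)) ?_
    · simpa [contDiffWithinAt_univ] using this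
    · rw [PartialEquiv.trans_source, PartialEquiv.symm_source]
      refine ⟨(extChartAt (𝓡 n) p).map_source hp', ?_⟩
      rw [mem_preimage, (extChartAt (𝓡 n) p).left_inv hp']
      rwa [extChartAt_source]
  obtain ⟨K', u, hu, hK'⟩ := (hc.of_le (by norm_cast)).exists_lipschitzOnWith
  have hcont : ContinuousAt (extChartAt (𝓡 n) p ∘ g) t :=
    (continuousAt_extChartAt' hp').comp hg
  have hsrc : ∀ᶠ r in 𝓝 t, g r ∈ (extChartAt (𝓡 n) p).source :=
    hg ((isOpen_extChartAt_source p).mem_nhds hp')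
  refine ⟨K' * K, _, inter_mem hs (inter_mem (hcont hu) hsrc), ?_⟩
  refine LipschitzOnWith.congr_eqOn (f := (extChartAt (𝓡 n) q ∘ (extChartAt (𝓡 n) p).symm) ∘
    (extChartAt (𝓡 n) p ∘ g)) ?_ ?_
  · exact hK'.comp (hK.mono inter_subset_left) fun r hr => hr.2.1
  · intro r hr
    simp only [Function.comp_apply]
    rw [(extChartAt (𝓡 n) p).left_inv hr.2.2]

theorem LipschitzNear.exists_lipschitzOnWith [IsManifold (𝓡 n) ∞ M] {p : M} {g : ℝ → M} {t : ℝ}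
    (h : LipschitzNear n g t) (hp : g t ∈ (chartAt (EuclideanSpace ℝ (Fin n)) p).source) :
    ∃ K : ℝ≥0, ∃ s ∈ 𝓝 t, LipschitzOnWith K (extChartAt (𝓡 n) p ∘ g) s :=
  exists_lipschitzOnWith_extChartAt_comp h.1 (mem_chart_source _ _) hp h.2

theorem LipschitzNear.of_chart [IsManifold (𝓡 n) ∞ M] {p : M} {g : ℝ → M} {t : ℝ}
    (hg : ContinuousAt g t) (hp : g t ∈ (chartAt (EuclideanSpace ℝ (Fin n)) p).source)
    (h : ∃ K : ℝ≥0, ∃ s ∈ 𝓝 t, LipschitzOnWith K (extChartAt (𝓡 n) p ∘ g) s) :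
    LipschitzNear n g t :=
  ⟨hg, exists_lipschitzOnWith_extChartAt_comp hg hp (mem_chart_source _ _) h⟩

theorem LipschitzNear.congr {g g' : ℝ → M} {t : ℝ} (h : LipschitzNear n g t)
    (hg : g' =ᶠ[𝓝 t] g) : LipschitzNear n g' t := by
  obtain ⟨hc, K, s, hs, hK⟩ := h
  refine ⟨hc.congr hg.symm, K, _, inter_mem hs hg, ?_⟩
  refine (hK.mono inter_subset_left).congr_eqOn fun r hr => ?_
  simp only [Function.comp_apply]
  rw [hg.eq_of_nhds, show g' r = g r from hr.2]

theorem LipschitzNear.comp {g : ℝ → M} {h : ℝ → ℝ} {K : ℝ≥0} {t : ℝ}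
    (hg : LipschitzNear n g (h t)) (hK : LipschitzWith K h) : LipschitzNear n (g ∘ h) t := by
  obtain ⟨hc, K', s, hs, hK'⟩ := hg
  exact ⟨hc.comp hK.continuous.continuousAt, K' * K, h ⁻¹' s, hK.continuous.continuousAt hs,
    hK'.comp hK.lipschitzOnWith (mapsTo_preimage h s)⟩

variable [IsManifold (𝓡 n) ∞ M] {V : Type*} [NormedAddCommGroup V] [NormedSpace ℝ V]

/-- The linear map `θ_q` read in the chart at `p`. -/
noncomputable def Coframing.coordForm (θ : Coframing n M V) (p q : M) :
    EuclideanSpace ℝ (Fin n) →L[ℝ] V :=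
  (θ.form q).comp ((trivializationAt (EuclideanSpace ℝ (Fin n)) (TangentSpace (𝓡 n)) p).symmL ℝ q)

theorem Coframing.contMDiffAt_coordForm (θ : Coframing n M V) (p : M) :
    ContMDiffAt (𝓡 n) 𝓘(ℝ, EuclideanSpace ℝ (Fin n) →L[ℝ] V) ∞ (θ.coordForm p) p := by
  refine ((contMDiffAt_hom_bundle _).1 (θ.contMDiff p)).2.congr_of_eventuallyEq ?_
  refine Eventually.of_forall fun q => ?_
  ext v
  simp [coordForm, ContinuousLinearMap.inCoordinates]

theorem Coframing.bijective_coordForm (θ : Coframing n M V) {p q : M}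
    (hq : q ∈ (chartAt (EuclideanSpace ℝ (Fin n)) p).source) :
    Function.Bijective (θ.coordForm p q) := by
  refine (θ.bijective q).comp (Function.bijective_iff_has_inverse.2
    ⟨(trivializationAt (EuclideanSpace ℝ (Fin n)) (TangentSpace (𝓡 n)) p).continuousLinearMapAt ℝ q,
      ?_, ?_⟩)
  · intro v
    exact Bundle.Trivialization.continuousLinearMapAt_symmL _ hq v
  · intro v
    exact Bundle.Trivialization.symmL_continuousLinearMapAt _ hq v

theorem mdifferentiableAt_curve_iff {p : M} {g : ℝ → M} {s : ℝ} (hg : ContinuousAt g s)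
    (hp : g s ∈ (chartAt (EuclideanSpace ℝ (Fin n)) p).source) :
    MDifferentiableAt 𝓘(ℝ, ℝ) (𝓡 n) g s ↔
      DifferentiableAt ℝ (extChartAt (𝓡 n) p ∘ g) s := by
  have : IsManifold (𝓡 n) 1 M := IsManifold.of_le (n := ∞) (by norm_cast)
  rw [mdifferentiableAt_iff_of_mem_source (I := 𝓘(ℝ, ℝ)) (x := s) (mem_chart_source _ _) hp]
  simp only [hg, true_and, modelWithCornersSelf_coe, range_id, differentiableWithinAt_univ,
    extChartAt_self_eq]
  rfl

/-- The chain rule, where the curve is differentiable. Elsewhere both sides vanish by the default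
values of `mfderiv` and `deriv`, so differentiability need not be assumed. -/
theorem Coframing.form_velocity (θ : Coframing n M V) {p : M} {g : ℝ → M} {s : ℝ}
    (hg : ContinuousAt g s) (hp : g s ∈ (chartAt (EuclideanSpace ℝ (Fin n)) p).source) :
    θ.form (g s) (velocity n g s) =
      θ.coordForm p (g s) (deriv (extChartAt (𝓡 n) p ∘ g) s) := by
  have : IsManifold (𝓡 n) 1 M := IsManifold.of_le (n := ∞) (by norm_cast)
  by_cases hd : MDifferentiableAt 𝓘(ℝ, ℝ) (𝓡 n) g s
  · have h1 : deriv (extChartAt (𝓡 n) p ∘ g) s =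
        (trivializationAt (EuclideanSpace ℝ (Fin n)) (TangentSpace (𝓡 n)) p).continuousLinearMapAt
          ℝ (g s) (velocity n g s) := by
      rw [TangentBundle.continuousLinearMapAt_trivializationAt hp, ← fderiv_apply_one_eq_deriv,
        ← mfderiv_eq_fderiv, mfderiv_comp s (mdifferentiableAt_extChartAt hp) hd]
      rfl
    rw [h1]
    simp only [coordForm, ContinuousLinearMap.comp_apply]
    congr 1
    exact (Bundle.Trivialization.symmL_continuousLinearMapAt _ hp _).symm
  · have h1 : velocity n g s = 0 := by
      rw [velocity, mfderiv_zero_of_not_mdifferentiableAt hd]; rfl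
    rw [h1, deriv_zero_of_not_differentiableAt fun h => hd
      ((mdifferentiableAt_curve_iff hg hp).2 h)]
    simp

theorem Coframing.form_velocity_congr (θ : Coframing n M V) {g g' : ℝ → M} {t : ℝ}
    (h : g =ᶠ[𝓝 t] g') (hg : ContinuousAt g t) :
    θ.form (g t) (velocity n g t) = θ.form (g' t) (velocity n g' t) := by
  rw [θ.form_velocity hg (mem_chart_source _ _),
    θ.form_velocity (p := g t) (hg.congr h) (by rw [← h.eq_of_nhds]; exact mem_chart_source _ _),
    (h.fun_comp _).deriv_eq, h.eq_of_nhds]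

end Charts

/-! ### Uniform control of the coframing on a chart ball -/

section ChartData

variable {n : ℕ} {M : Type*} [TopologicalSpace M] [ChartedSpace (EuclideanSpace ℝ (Fin n)) M]
  [IsManifold (𝓡 n) ∞ M] {V : Type*} [NormedAddCommGroup V] [NormedSpace ℝ V]

/-- A ball in the chart at `p` on which the coframing, read in the chart as the family of linear
isomorphisms `Θ y`, is under control, together with the family of inverses `F y`. -/
structure Coframing.ChartData (θ : Coframing n M V) (p : M) where
  r : ℝ
  r_pos : 0 < r
  K : ℝ≥0
  Θ : EuclideanSpace ℝ (Fin n) → EuclideanSpace ℝ (Fin n) →L[ℝ] V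
  F : EuclideanSpace ℝ (Fin n) → V →L[ℝ] EuclideanSpace ℝ (Fin n)
  subset : Metric.closedBall (extChartAt (𝓡 n) p p) r ⊆ (extChartAt (𝓡 n) p).target
  F_Θ : ∀ y ∈ Metric.closedBall (extChartAt (𝓡 n) p p) r, ∀ v, F y (Θ y v) = v
  Θ_F : ∀ y ∈ Metric.closedBall (extChartAt (𝓡 n) p p) r, ∀ w, Θ y (F y w) = w
  lip : LipschitzOnWith K F (Metric.closedBall (extChartAt (𝓡 n) p p) r)
  norm_F_le : ∀ y ∈ Metric.closedBall (extChartAt (𝓡 n) p p) r, ‖F y‖ ≤ K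
  norm_Θ_le : ∀ y ∈ Metric.closedBall (extChartAt (𝓡 n) p p) r, ∀ v,
    ‖Θ y v‖ ≤ 2 * ‖Θ (extChartAt (𝓡 n) p p) v‖
  le_norm_Θ : ∀ y ∈ Metric.closedBall (extChartAt (𝓡 n) p p) r, ∀ v,
    ‖Θ (extChartAt (𝓡 n) p p) v‖ ≤ 2 * ‖Θ y v‖
  continuousOn_Θ : ContinuousOn Θ (Metric.closedBall (extChartAt (𝓡 n) p p) r)
  form_velocity : ∀ (g : ℝ → M) (s : ℝ), ContinuousAt g s → g s ∈ (extChartAt (𝓡 n) p).source →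
    θ.form (g s) (velocity n g s) =
      Θ (extChartAt (𝓡 n) p (g s)) (deriv (extChartAt (𝓡 n) p ∘ g) s)

/-- Inversion of linear isomorphisms is smooth, so `F` is `C¹` and thus Lipschitz near the centre.
The comparisons with factor 2 hold by continuity: `Θ y ∘ F (φ p)` and `Θ (φ p) ∘ F y` are the
identity at the centre, of norm at most 1. -/
theorem Coframing.nonempty_chartData [FiniteDimensional ℝ V] (θ : Coframing n M V) (p : M) :
    Nonempty (θ.ChartData p) := by
  have : CompleteSpace V := FiniteDimensional.complete ℝ V
  set φ := extChartAt (𝓡 n) p with hφ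
  let Θ : EuclideanSpace ℝ (Fin n) → EuclideanSpace ℝ (Fin n) →L[ℝ] V :=
    fun y => θ.coordForm p (φ.symm y)
  have hp : φ.symm (φ p) = p := extChartAt_to_inv p
  have hsrc : ∀ y ∈ φ.target, φ.symm y ∈ (chartAt (EuclideanSpace ℝ (Fin n)) p).source := by
    intro y hy
    have := φ.map_target hy
    rwa [hφ, extChartAt_source] at this
  have hΘ : ContDiffAt ℝ ∞ Θ (φ p) := by
    have h1 : ContMDiffAt 𝓘(ℝ, EuclideanSpace ℝ (Fin n)) (𝓡 n) ∞ φ.symm (φ p) :=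
      (contMDiffOn_extChartAt_symm p).contMDiffAt (extChartAt_target_mem_nhds p)
    have h2 : ContMDiffAt (𝓡 n) 𝓘(ℝ, EuclideanSpace ℝ (Fin n) →L[ℝ] V) ∞ (θ.coordForm p)
        (φ.symm (φ p)) := by rw [hp]; exact θ.contMDiffAt_coordForm p
    have h3 := h2.comp (φ p) h1
    rw [contMDiffAt_iff_contDiffAt] at h3
    exact h3
  have hbij : ∀ y ∈ φ.target, ∃ e : EuclideanSpace ℝ (Fin n) ≃L[ℝ] V,
      (e : EuclideanSpace ℝ (Fin n) →L[ℝ] V) = Θ y := by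
    intro y hy
    have hb := θ.bijective_coordForm (hsrc y hy)
    exact ⟨ContinuousLinearEquiv.ofBijective (Θ y) (LinearMap.ker_eq_bot.2 hb.1)
      (LinearMap.range_eq_top.2 hb.2), ContinuousLinearEquiv.coe_ofBijective _ _ _⟩
  let F : EuclideanSpace ℝ (Fin n) → V →L[ℝ] EuclideanSpace ℝ (Fin n) :=
    fun y => (Θ y).inverse
  have hFΘ : ∀ y ∈ φ.target, (∀ v, F y (Θ y v) = v) ∧ ∀ w, Θ y (F y w) = w := by
    intro y hy
    obtain ⟨e, he⟩ := hbij y hy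
    have : F y = e.symm := by simp only [F, ← he, ContinuousLinearMap.inverse_equiv]
    rw [this, ← he]
    exact ⟨e.symm_apply_apply, e.apply_symm_apply⟩
  have htarget : φ p ∈ φ.target := mem_extChartAt_target p
  have hF : ContDiffAt ℝ ∞ F (φ p) := by
    obtain ⟨e, he⟩ := hbij _ htarget
    have := contDiffAt_map_inverse (n := ∞) e
    rw [he] at this
    exact this.comp (φ p) hΘ
  obtain ⟨K, u, hu, hK⟩ := (hF.of_le (m := 1) (by norm_cast)).exists_lipschitzOnWith
  have h1 : ∀ᶠ y in 𝓝 (φ p), ‖F y‖ < ‖F (φ p)‖ + 1 :=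
    hF.continuousAt.norm.eventually_lt_const (by linarith)
  have h2 : ∀ᶠ y in 𝓝 (φ p), ‖(Θ y).comp (F (φ p))‖ < 2 := by
    have hc : ContinuousAt (fun y => ‖(Θ y).comp (F (φ p))‖) (φ p) :=
      (hΘ.continuousAt.clm_comp continuousAt_const).norm
    refine hc.eventually_lt_const ?_
    have : (Θ (φ p)).comp (F (φ p)) = ContinuousLinearMap.id ℝ V := by
      ext w; exact (hFΘ _ htarget).2 w
    simp only [this]
    exact ContinuousLinearMap.norm_id_le.trans_lt one_lt_two
  have h3 : ∀ᶠ y in 𝓝 (φ p), ‖(Θ (φ p)).comp (F y)‖ < 2 := by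
    have hc : ContinuousAt (fun y => ‖(Θ (φ p)).comp (F y)‖) (φ p) :=
      (continuousAt_const.clm_comp hF.continuousAt).norm
    refine hc.eventually_lt_const ?_
    have : (Θ (φ p)).comp (F (φ p)) = ContinuousLinearMap.id ℝ V := by
      ext w; exact (hFΘ _ htarget).2 w
    simp only [this]
    exact ContinuousLinearMap.norm_id_le.trans_lt one_lt_two
  have h4 : ∀ᶠ y in 𝓝 (φ p), ContinuousAt Θ y :=
    ((hΘ.of_le (m := 1) (by norm_cast)).eventually (by simp)).mono
      fun y hy => hy.continuousAt
  obtain ⟨r, hr, hsub⟩ := Metric.nhds_basis_closedBall.mem_iff.1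
    (inter_mem (inter_mem hu (extChartAt_target_mem_nhds (I := 𝓡 n) p))
      (h1.and (h2.and (h3.and h4))))
  have ht : ∀ y ∈ Metric.closedBall (φ p) r, y ∈ φ.target := fun y hy => (hsub hy).1.2
  refine ⟨⟨r, hr, max K (‖F (φ p)‖ + 1).toNNReal, Θ, F, ht, fun y hy => (hFΘ y (ht y hy)).1,
    fun y hy => (hFΘ y (ht y hy)).2, ?_, ?_, ?_, ?_, ?_, ?_⟩⟩
  · exact (hK.mono fun y hy => (hsub hy).1.1).weaken (le_max_left _ _)
  · intro y hy
    refine (hsub hy).2.1.le.trans ?_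
    rw [NNReal.coe_max]
    exact (Real.le_coe_toNNReal _).trans (le_max_right _ _)
  · intro y hy v
    have := ((Θ y).comp (F (φ p))).le_of_opNorm_le (hsub hy).2.2.1.le (Θ (φ p) v)
    rwa [ContinuousLinearMap.comp_apply, (hFΘ _ htarget).1] at this
  · intro y hy v
    have := ((Θ (φ p)).comp (F y)).le_of_opNorm_le (hsub hy).2.2.2.1.le (Θ y v)
    rwa [ContinuousLinearMap.comp_apply, (hFΘ y (ht y hy)).1] at this
  · exact fun y hy => (hsub hy).2.2.2.2.continuousWithinAt
  · intro g s hg hs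
    rw [θ.form_velocity (p := p) hg (by rwa [extChartAt_source] at hs)]
    simp only [Θ]
    rw [φ.left_inv hs]

end ChartData

/-! ### Lipschitz functions and Carathéodory equations -/

section Analysis

/-- A norming functional reduces to a real-valued Lipschitz function, which is absolutely continuous
and so is the integral of its derivative. -/
theorem LipschitzOnWith.norm_sub_le_of_ae_hasDerivAt {E : Type*} [NormedAddCommGroup E]
    [NormedSpace ℝ E] {z : ℝ → E} {K : ℝ≥0} {a b c : ℝ} (hz : LipschitzOnWith K z (uIcc a b))
    (h : ∀ᵐ s : ℝ, s ∈ uIcc a b → ∃ z', HasDerivAt z z' s ∧ ‖z'‖ ≤ c) :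
    ‖z b - z a‖ ≤ c * |b - a| := by
  obtain ⟨ℓ, hℓ, hval⟩ := exists_dual_vector'' ℝ (z b - z a)
  have hlip : LipschitzOnWith (‖ℓ‖₊ * K) (ℓ ∘ z) (uIcc a b) := ℓ.lipschitz.comp_lipschitzOnWith hz
  have hint := hlip.absolutelyContinuousOnInterval.integral_deriv_eq_sub
  have hle : ‖∫ s in a..b, deriv (ℓ ∘ z) s‖ ≤ c * |b - a| := by
    refine intervalIntegral.norm_integral_le_of_norm_le_const_ae ?_
    filter_upwards [h] with s hs hs'
    obtain ⟨z', hz', hc⟩ := hs (uIoc_subset_uIcc hs')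
    rw [(ℓ.hasFDerivAt.comp_hasDerivAt s hz').deriv]
    exact ((ℓ.le_of_opNorm_le hℓ z').trans (by simp)).trans hc
  rw [hint] at hle
  simp only [Function.comp_apply, ← map_sub, hval] at hle
  simpa using hle

/-- A null set is mapped by a monotone Lipschitz change of parameter from a set where the
derivative vanishes almost everywhere. -/
theorem ae_hasDerivAt_zero_of_injective {h : ℝ → ℝ} {K : ℝ≥0} (hK : LipschitzWith K h)
    (hinj : Function.Injective h) {P : ℝ → Prop} (hP : ∀ᵐ s, P s) :
    ∀ᵐ s, P (h s) ∨ HasDerivAt h 0 s := by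
  obtain ⟨N, hN, hNm, hN0⟩ := exists_measurable_superset_of_null (ae_iff.1 hP)
  have hmeas : MeasurableSet {s | DifferentiableAt ℝ h s} := measurableSet_of_differentiableAt ℝ h
  have hS : MeasurableSet (h ⁻¹' N ∩ {s | DifferentiableAt ℝ h s}) :=
    (hK.continuous.measurable hNm).inter hmeas
  -- By the area formula, the integral of `|h'|` over the preimage of `N` is the measure of its
  -- image, which lies in the null set `N`.
  have key := lintegral_image_eq_lintegral_abs_deriv_mul hS
    (fun s hs => hs.2.hasDerivAt.hasDerivWithinAt) hinj.injOn (fun _ => 1)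
  have h0 : ∫⁻ s in h ⁻¹' N ∩ {s | DifferentiableAt ℝ h s}, ENNReal.ofReal |deriv h s| = 0 := by
    simp only [mul_one] at key
    rw [← key, setLIntegral_one]
    exact measure_mono_null (by rintro _ ⟨s, hs, rfl⟩; exact hs.1) hN0
  rw [lintegral_eq_zero_iff (measurable_deriv h).abs.ennreal_ofReal,
    EventuallyEq, ae_restrict_iff' hS] at h0
  filter_upwards [h0, hK.ae_differentiableAt_real] with s hs hd
  by_cases hsN : h s ∈ N
  · right
    have := hs ⟨hsN, hd⟩
    simp only [Pi.zero_apply, ENNReal.ofReal_eq_zero] at this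
    rw [← abs_eq_zero.1 (le_antisymm this (abs_nonneg _))]
    exact hd.hasDerivAt
  · left
    by_contra hc
    exact hsN (hN hc)

open BoundedContinuousFunction in
/-- Carathéodory's existence theorem for the equation `y' = F(y) w` with globally Lipschitz `F` and
integrable `w` with small integral. -/
theorem exists_integral_equation {E V : Type*} [NormedAddCommGroup E] [NormedSpace ℝ E]
    [CompleteSpace E] [NormedAddCommGroup V] [NormedSpace ℝ V]
    {F : E → V →L[ℝ] E} {K : ℝ≥0} (hF : LipschitzWith K F) {w : ℝ → V} (hw : Integrable w)
    {κ : ℝ≥0} (hκ : ∫ s, ‖w s‖ ≤ κ) (hKκ : K * κ < 1) (t₀ : ℝ) (q : E) :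
    ∃ y : ℝ →ᵇ E, Integrable (fun s => F (y s) (w s)) ∧
      ∀ t, y t = q + ∫ s in t₀..t, F (y s) (w s) := by
  have hmeas : ∀ y : ℝ →ᵇ E, AEStronglyMeasurable (fun s => F (y s) (w s)) := fun y =>
    (ContinuousLinearMap.id ℝ (V →L[ℝ] E)).aestronglyMeasurable_comp₂
      (hF.continuous.comp y.continuous).aestronglyMeasurable hw.aestronglyMeasurable
  have hbd : ∀ y : ℝ →ᵇ E, ∀ s, ‖F (y s) (w s)‖ ≤ (‖F 0‖ + K * ‖y‖) * ‖w s‖ := by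
    intro y s
    refine (F (y s)).le_of_opNorm_le ?_ _
    have h1 : ‖F (y s) - F 0‖ ≤ K * ‖y s‖ := by simpa using hF.norm_sub_le (y s) 0
    have h2 : ‖y s‖ ≤ ‖y‖ := y.norm_coe_le_norm s
    have h3 : ‖F (y s)‖ ≤ ‖F 0‖ + ‖F (y s) - F 0‖ := by
      simpa using norm_add_le (F 0) (F (y s) - F 0)
    have h4 : (K : ℝ) * ‖y s‖ ≤ K * ‖y‖ := by gcongr
    linarith
  have hint : ∀ y : ℝ →ᵇ E, Integrable (fun s => F (y s) (w s)) := fun y =>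
    (hw.norm.const_mul _).mono' (hmeas y) (Eventually.of_forall (hbd y))
  have hnorm : ∀ (G : ℝ → E) (_ : Integrable G) (t : ℝ), ‖∫ s in t₀..t, G s‖ ≤ ∫ s, ‖G s‖ := by
    intro G hG t
    refine (intervalIntegral.norm_integral_le_integral_norm_uIoc).trans ?_
    exact setIntegral_le_integral hG.norm (Eventually.of_forall fun s => norm_nonneg _)
  -- The Picard operator acts on functions on the whole line, as `w` is integrable; the small
  -- integral of `‖w‖` takes the place of a short interval in making it contract.
  let T : (ℝ →ᵇ E) → (ℝ →ᵇ E) := fun y =>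
    BoundedContinuousFunction.ofNormedAddCommGroup (fun t => q + ∫ s in t₀..t, F (y s) (w s))
      (continuous_const.add (intervalIntegral.continuous_primitive
        (fun a b => (hint y).intervalIntegrable) t₀))
      (‖q‖ + ∫ s, ‖F (y s) (w s)‖)
      (fun t => (norm_add_le _ _).trans (by gcongr; exact hnorm _ (hint y) t))
  have hT : ContractingWith (K * κ) T := by
    refine ⟨hKκ, LipschitzWith.of_dist_le_mul fun y z => ?_⟩
    rw [BoundedContinuousFunction.dist_le (by positivity)]
    intro t
    have h1 : T y t - T z t = ∫ s in t₀..t, (F (y s) (w s) - F (z s) (w s)) := by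
      rw [intervalIntegral.integral_sub (hint y).intervalIntegrable (hint z).intervalIntegrable]
      simp [T]
    rw [dist_eq_norm, h1]
    refine (hnorm _ ((hint y).sub (hint z)) t).trans ?_
    calc ∫ s, ‖F (y s) (w s) - F (z s) (w s)‖ ≤ ∫ s, K * dist y z * ‖w s‖ := by
          refine integral_mono ((hint y).sub (hint z)).norm (hw.norm.const_mul _) fun s => ?_
          have h2 : ‖F (y s) - F (z s)‖ ≤ K * dist y z := by
            refine (hF.norm_sub_le _ _).trans ?_
            rw [← dist_eq_norm]
            gcongr
            exact BoundedContinuousFunction.dist_coe_le_dist s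
          exact (F (y s) - F (z s)).le_of_opNorm_le h2 (w s)
      _ = K * dist y z * ∫ s, ‖w s‖ := integral_const_mul _ _
      _ ≤ K * dist y z * κ := by gcongr
      _ = _ := by push_cast; ring
  have hfix := hT.fixedPoint_isFixedPt
  refine ⟨ContractingWith.fixedPoint T hT, hint _, fun t => ?_⟩
  conv_lhs => rw [← hfix]
  rfl

/-- Solutions of `y' = F(y) w`, for `F` Lipschitz and bounded by `K` on a ball: there is a time `δ`
on which they exist for all `w` bounded by `C`. -/
theorem exists_caratheodory_solution {E V : Type*} [NormedAddCommGroup E] [NormedSpace ℝ E]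
    [FiniteDimensional ℝ E] [NormedAddCommGroup V] [NormedSpace ℝ V] [FiniteDimensional ℝ V]
    {F : E → V →L[ℝ] E} {K : ℝ≥0} {y₀ : E} {r : ℝ} (hr : 0 < r)
    (hF : LipschitzOnWith K F (Metric.closedBall y₀ r))
    (hK : ∀ y ∈ Metric.closedBall y₀ r, ‖F y‖ ≤ K) (C : ℝ≥0) :
    ∃ δ > 0, ∀ q ∈ Metric.closedBall y₀ (r / 2), ∀ (t₀ : ℝ) (w : ℝ → V),
      AEStronglyMeasurable w → (∀ᵐ s, s ∈ Metric.ball t₀ δ → ‖w s‖ ≤ C) →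
      ∃ y : ℝ → E, y t₀ = q ∧ (∃ K', LipschitzWith K' y) ∧ (∀ t, y t ∈ Metric.closedBall y₀ r) ∧
        ∀ᵐ s, s ∈ Metric.ball t₀ δ → HasDerivAt y (F (y s) (w s)) s := by
  have : CompleteSpace E := FiniteDimensional.complete ℝ E
  -- A global Lipschitz extension, with a worse constant; the solution will be shown to stay in the
  -- ball, where `F' = F`.
  obtain ⟨F', hF', heq⟩ := hF.extend_finite_dimension
  set K' := lipschitzExtensionConstant (V →L[ℝ] E) * K with hK'
  -- Here `2 * δ * C` bounds the integral of `‖w‖` over the time ball. The first inequality makes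
  -- the Picard operator contract; both together confine the solution to the ball.
  obtain ⟨δ, hδ, hδ1, hδ2⟩ : ∃ δ : ℝ≥0, 0 < δ ∧ K' * (2 * δ * C) < 1 / 2 ∧
      K * (2 * δ * C) < r.toNNReal / 4 := by
    have h : ∀ a : ℝ≥0, Tendsto (fun δ : ℝ≥0 => a * (2 * δ * C)) (𝓝 0) (𝓝 (a * (2 * 0 * C))) :=
      fun a => Continuous.tendsto (by fun_prop) 0
    have h3 := ((h K').eventually_lt_const (u := 1 / 2) (by simp)).and
      ((h K).eventually_lt_const (u := r.toNNReal / 4) (by simpa using hr))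
    obtain ⟨δ, h, hpos⟩ := ((h3.filter_mono nhdsWithin_le_nhds).and
      (self_mem_nhdsWithin : Ioi (0 : ℝ≥0) ∈ 𝓝[>] 0)).exists
    exact ⟨δ, hpos, h.1, h.2⟩
  rw [← NNReal.coe_lt_coe] at hδ1 hδ2
  push_cast [Real.coe_toNNReal r hr.le] at hδ1 hδ2
  refine ⟨δ, hδ, fun q hq t₀ w hwm hwC => ?_⟩
  -- Nothing is known of `w` off the time ball; the truncation is integrable on the line.
  let w' : ℝ → V := (Metric.ball t₀ δ).indicator w
  have hw'm : AEStronglyMeasurable w' := hwm.indicator Metric.isOpen_ball.measurableSet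
  have hw'C : ∀ᵐ s, ‖w' s‖ ≤ (Metric.ball t₀ (δ : ℝ)).indicator (fun _ => (C : ℝ)) s := by
    filter_upwards [hwC] with s hs
    by_cases h : s ∈ Metric.ball t₀ (δ : ℝ)
    · simpa [w', h] using hs h
    · simp [w', h]
  have hind : Integrable ((Metric.ball t₀ (δ : ℝ)).indicator (fun _ => (C : ℝ))) :=
    (integrable_indicator_iff Metric.isOpen_ball.measurableSet).2 (integrableOn_const measure_ball_lt_top.ne)
  have hw' : Integrable w' := hind.mono' hw'm hw'C
  have hκ : ∫ s, ‖w' s‖ ≤ (2 * δ * C : ℝ≥0) := by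
    refine (integral_mono_ae hw'.norm hind hw'C).trans ?_
    rw [integral_indicator Metric.isOpen_ball.measurableSet]
    simp [Real.volume_real_ball]
  obtain ⟨y, hyi, hy⟩ := exists_integral_equation hF' hw' hκ
    (by rw [← NNReal.coe_lt_coe]; push_cast; linarith) t₀ q
  have hq' : q ∈ Metric.closedBall y₀ r := Metric.closedBall_subset_closedBall (by linarith) hq
  set D := dist y (BoundedContinuousFunction.const ℝ q) with hD
  have hyD : ∀ t, ‖y t - q‖ ≤ D := fun t => by
    rw [← dist_eq_norm]
    exact BoundedContinuousFunction.dist_coe_le_dist (g := BoundedContinuousFunction.const ℝ q) t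
  have hD0 : 0 ≤ D := dist_nonneg
  have hF'y : ∀ t, ‖F' (y t)‖ ≤ K + K' * D := fun t => by
    have h1 : ‖F' (y t) - F' q‖ ≤ K' * D :=
      (hF'.norm_sub_le _ _).trans (by gcongr; exact hyD t)
    have h2 : ‖F' q‖ ≤ K := by rw [← heq hq']; exact hK q hq'
    have h3 : ‖F' (y t)‖ ≤ ‖F' q‖ + ‖F' (y t) - F' q‖ := by
      simpa using norm_add_le (F' q) (F' (y t) - F' q)
    linarith
  have hDle : D ≤ (K + K' * D) * (2 * δ * C) := by
    rw [hD, BoundedContinuousFunction.dist_le (by positivity)]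
    intro t
    rw [dist_eq_norm, hy t]
    simp only [BoundedContinuousFunction.const_apply, add_sub_cancel_left]
    calc ‖∫ s in t₀..t, F' (y s) (w' s)‖ ≤ ∫ s in uIoc t₀ t, ‖F' (y s) (w' s)‖ :=
          intervalIntegral.norm_integral_le_integral_norm_uIoc
      _ ≤ ∫ s, ‖F' (y s) (w' s)‖ :=
          setIntegral_le_integral hyi.norm (Eventually.of_forall fun s => norm_nonneg _)
      _ ≤ ∫ s, (K + K' * D) * ‖w' s‖ :=
          integral_mono hyi.norm (hw'.norm.const_mul _)
            fun s => (F' (y s)).le_of_opNorm_le (hF'y s) _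
      _ = (K + K' * D) * ∫ s, ‖w' s‖ := integral_const_mul _ _
      _ ≤ _ := by gcongr; exact_mod_cast hκ
  -- From `hDle`, `D ≤ r / 4 + D / 2`.
  have hDr : D ≤ r / 2 := by nlinarith
  have hyball : ∀ t, y t ∈ Metric.closedBall y₀ r := fun t => by
    rw [Metric.mem_closedBall] at hq ⊢
    have := dist_triangle (y t) q y₀
    rw [dist_eq_norm (y t) q] at this
    linarith [hyD t]
  have hbd : ∀ᵐ s, ‖F' (y s) (w' s)‖ ≤ K * C := by
    filter_upwards [hw'C] with s hs
    rw [← heq (hyball s)]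
    refine ((F (y s)).le_of_opNorm_le (hK _ (hyball s)) _).trans ?_
    gcongr
    exact hs.trans (indicator_le_self' (fun _ _ => C.2) s)
  refine ⟨y, by simp [hy t₀], ⟨K * C, LipschitzWith.of_dist_le_mul fun t t' => ?_⟩, hyball, ?_⟩
  · rw [dist_comm, dist_eq_norm, hy t, hy t', add_sub_add_left_eq_sub,
      intervalIntegral.integral_interval_sub_left hyi.intervalIntegrable hyi.intervalIntegrable,
      dist_comm, Real.dist_eq]
    exact intervalIntegral.norm_integral_le_of_norm_le_const_ae (hbd.mono fun s hs _ => hs)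
  · filter_upwards [_root_.LocallyIntegrable.ae_hasDerivAt_integral hyi.locallyIntegrable] with s hs hsb
    have h1 := (hs t₀).const_add q
    have h2 : w' s = w s := indicator_of_mem hsb w
    rw [h2, ← heq (hyball s)] at h1
    exact h1.congr_of_eventuallyEq (Eventually.of_forall hy)

end Analysis

/-! ### Curves with prescribed velocity: local theory -/

section HasVelocity

variable {n : ℕ} {M : Type*} [TopologicalSpace M] [ChartedSpace (EuclideanSpace ℝ (Fin n)) M]
  [IsManifold (𝓡 n) ∞ M] {V : Type*} [NormedAddCommGroup V] [NormedSpace ℝ V]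

/-- The exceptional set is null near each of its points, hence null, as `ℝ` is second countable. -/
theorem ae_of_forall_nhds {I : Set ℝ} {P : ℝ → Prop}
    (h : ∀ t ∈ I, ∃ U ∈ 𝓝 t, ∀ᵐ s : ℝ, s ∈ U → P s) : ∀ᵐ s : ℝ, s ∈ I → P s := by
  have : volume {s | s ∈ I ∧ ¬ P s} = 0 := by
    refine measure_null_of_locally_null _ fun t ht => ?_
    obtain ⟨U, hU, h'⟩ := h t ht.1
    refine ⟨U ∩ {s | s ∈ I ∧ ¬ P s}, inter_mem (mem_nhdsWithin_of_mem_nhds hU)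
      self_mem_nhdsWithin, ?_⟩
    refine measure_mono_null ?_ (ae_iff.1 h')
    intro s hs
    simp only [mem_ofPred_eq, Classical.not_imp]
    exact ⟨hs.1, hs.2.2⟩
  rw [ae_iff]
  refine measure_mono_null ?_ this
  intro s hs
  simpa only [mem_ofPred_eq, Classical.not_imp] using hs

/-- The curve `g` is Lipschitz near all times in `I`, and the coframing takes the value `w s` on its
velocity at almost every time `s` in `I`. -/
def Coframing.HasVelocityOn (θ : Coframing n M V) (w : ℝ → V) (I : Set ℝ) (g : ℝ → M) : Prop :=
  (∀ t ∈ I, LipschitzNear n g t) ∧ ∀ᵐ s, s ∈ I → θ.form (g s) (velocity n g s) = w s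

namespace Coframing

variable {θ : Coframing n M V} {w w' : ℝ → V} {I J : Set ℝ} {g g' : ℝ → M}

theorem HasVelocityOn.mono (h : θ.HasVelocityOn w J g) (hIJ : I ⊆ J) : θ.HasVelocityOn w I g :=
  ⟨fun t ht => h.1 t (hIJ ht), h.2.mono fun _ hs hI => hs (hIJ hI)⟩

theorem HasVelocityOn.congr_ae (h : θ.HasVelocityOn w I g) (hw : ∀ᵐ s, s ∈ I → w s = w' s) :
    θ.HasVelocityOn w' I g :=
  ⟨h.1, by filter_upwards [h.2, hw] with s h1 h2 hs using (h1 hs).trans (h2 hs)⟩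

theorem HasVelocityOn.continuousOn (h : θ.HasVelocityOn w I g) : ContinuousOn g I :=
  fun t ht => (h.1 t ht).1.continuousWithinAt

theorem HasVelocityOn.congr (h : θ.HasVelocityOn w I g) (hI : IsOpen I) (hg : EqOn g' g I) :
    θ.HasVelocityOn w I g' := by
  have hev : ∀ t ∈ I, g' =ᶠ[𝓝 t] g := fun t ht => hg.eventuallyEq_of_mem (hI.mem_nhds ht)
  refine ⟨fun t ht => (h.1 t ht).congr (hev t ht), ?_⟩
  filter_upwards [h.2] with s hs hsI
  rw [← hs hsI]
  exact θ.form_velocity_congr (hev s hsI) ((h.1 s hsI).congr (hev s hsI)).1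

theorem hasVelocityOn_of_forall_nhds (h : ∀ t ∈ I, ∃ U ∈ 𝓝 t, θ.HasVelocityOn w U g) :
    θ.HasVelocityOn w I g := by
  refine ⟨fun t ht => ?_, ae_of_forall_nhds fun t ht => ?_⟩
  · obtain ⟨U, hU, h'⟩ := h t ht
    exact h'.1 t (mem_of_mem_nhds hU)
  · obtain ⟨U, hU, h'⟩ := h t ht
    exact ⟨U, hU, h'.2⟩

/-- The local description in a chart of a locally Lipschitz curve. -/
theorem ChartData.exists_ball {p : M} (D : θ.ChartData p) (hI : IsOpen I)
    (hg : ∀ t ∈ I, LipschitzNear n g t) {t : ℝ} (ht : t ∈ I) (hp : g t = p) :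
    ∃ ε > 0, ∃ K C : ℝ≥0, Metric.ball t ε ⊆ I ∧
      LipschitzOnWith K (extChartAt (𝓡 n) p ∘ g) (Metric.ball t ε) ∧
      ∀ s ∈ Metric.ball t ε, g s ∈ (extChartAt (𝓡 n) p).source ∧
        extChartAt (𝓡 n) p (g s) ∈ Metric.closedBall (extChartAt (𝓡 n) p p) D.r ∧
        θ.form (g s) (velocity n g s) =
          D.Θ (extChartAt (𝓡 n) p (g s)) (deriv (extChartAt (𝓡 n) p ∘ g) s) ∧
        ‖θ.form (g s) (velocity n g s)‖ ≤ C := by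
  have hgt := hg t ht
  have hsrc : g t ∈ (extChartAt (𝓡 n) p).source := by rw [hp]; exact mem_extChartAt_source p
  obtain ⟨K, s, hs, hK⟩ := hgt.exists_lipschitzOnWith (p := p) (by rwa [extChartAt_source] at hsrc)
  have h1 : ∀ᶠ r in 𝓝 t, g r ∈ (extChartAt (𝓡 n) p).source :=
    hgt.1 ((isOpen_extChartAt_source p).mem_nhds hsrc)
  have h2 : ∀ᶠ r in 𝓝 t,
      extChartAt (𝓡 n) p (g r) ∈ Metric.closedBall (extChartAt (𝓡 n) p p) D.r := by
    refine ((continuousAt_extChartAt' hsrc).comp hgt.1) ?_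
    simp only [Function.comp_apply, hp]
    exact Metric.closedBall_mem_nhds _ D.r_pos
  obtain ⟨ε, hε, hsub⟩ := Metric.mem_nhds_iff.1
    (inter_mem (inter_mem hs (hI.mem_nhds ht)) (h1.and h2))
  have hKε := hK.mono fun r hr => (hsub hr).1.1
  refine ⟨ε, hε, K, 2 * ‖D.Θ (extChartAt (𝓡 n) p p)‖₊ * K, fun r hr => (hsub hr).1.2, hKε,
    fun r hr => ?_⟩
  have hv := D.form_velocity g r (hg r (hsub hr).1.2).1 (hsub hr).2.1
  refine ⟨(hsub hr).2.1, (hsub hr).2.2, hv, ?_⟩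
  rw [hv]
  refine (D.norm_Θ_le _ (hsub hr).2.2 _).trans ?_
  push_cast
  rw [mul_assoc]
  gcongr
  refine (D.Θ _).le_of_opNorm_le_of_le le_rfl ?_
  exact norm_deriv_le_of_lipschitzOn (Metric.isOpen_ball.mem_nhds hr) hKε

/-- Passage from the equation on the manifold to `y' = F(y) w` in the chart, by inverting `Θ`. The
Lipschitz property of the curve bounds `w` near `t`. -/
theorem HasVelocityOn.exists_ball {p : M} (D : θ.ChartData p) (hI : IsOpen I)
    (h : θ.HasVelocityOn w I g) {t : ℝ} (ht : t ∈ I) (hp : g t = p) :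
    ∃ ε > 0, ∃ K C : ℝ≥0, Metric.ball t ε ⊆ I ∧
      LipschitzOnWith K (extChartAt (𝓡 n) p ∘ g) (Metric.ball t ε) ∧
      (∀ s ∈ Metric.ball t ε, g s ∈ (extChartAt (𝓡 n) p).source ∧
        extChartAt (𝓡 n) p (g s) ∈ Metric.closedBall (extChartAt (𝓡 n) p p) D.r) ∧
      ∀ᵐ s, s ∈ Metric.ball t ε → ‖w s‖ ≤ C ∧
        HasDerivAt (extChartAt (𝓡 n) p ∘ g) (D.F (extChartAt (𝓡 n) p (g s)) (w s)) s := by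
  obtain ⟨ε, hε, K, C, hsub, hK, hD⟩ := D.exists_ball hI h.1 ht hp
  refine ⟨ε, hε, K, C, hsub, hK, fun s hs => ⟨(hD s hs).1, (hD s hs).2.1⟩, ?_⟩
  filter_upwards [h.2, hK.ae_differentiableWithinAt_of_mem_real] with s h1 h2 hs
  obtain ⟨h3, h4, h5, h6⟩ := hD s hs
  have h7 := h1 (hsub hs)
  refine ⟨h7 ▸ h6, ?_⟩
  rw [← h7, h5, D.F_Θ _ h4]
  exact ((h2 hs).differentiableAt (Metric.isOpen_ball.mem_nhds hs)).hasDerivAt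

theorem ae_mdifferentiableAt_of_lipschitzNear [FiniteDimensional ℝ V] (θ : Coframing n M V)
    (hI : IsOpen I)
    (hg : ∀ t ∈ I, LipschitzNear n g t) :
    ∀ᵐ s, s ∈ I → MDifferentiableAt 𝓘(ℝ, ℝ) (𝓡 n) g s := by
  refine ae_of_forall_nhds fun t ht => ?_
  obtain ⟨D⟩ := θ.nonempty_chartData (g t)
  obtain ⟨ε, hε, K, C, hsub, hK, hD⟩ := D.exists_ball hI hg ht rfl
  refine ⟨_, Metric.ball_mem_nhds t hε, ?_⟩
  filter_upwards [hK.ae_differentiableWithinAt_of_mem_real] with s hs hsb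
  refine (mdifferentiableAt_curve_iff (hg s (hsub hsb)).1 (p := g t) ?_).2
    ((hs hsb).differentiableAt (Metric.isOpen_ball.mem_nhds hsb))
  have := (hD s hsb).1
  rwa [extChartAt_source] at this

/-- In a chart this is a continuous family of linear maps applied to a derivative, which is
measurable, and it is locally bounded. -/
theorem locallyIntegrable_form_velocity [FiniteDimensional ℝ V] (θ : Coframing n M V)
    (hg : IsLocallyLipschitz n g) :
    LocallyIntegrable (fun s => θ.form (g s) (velocity n g s)) := by
  intro t
  obtain ⟨D⟩ := θ.nonempty_chartData (g t)
  obtain ⟨ε, hε, K, C, hsub, hK, hD⟩ :=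
    D.exists_ball isOpen_univ (fun t _ => isLocallyLipschitz_iff.1 hg t) (mem_univ t) rfl
  refine ⟨_, Metric.ball_mem_nhds t hε, ?_⟩
  refine Integrable.mono' (g := fun _ => (C : ℝ)) (integrableOn_const measure_ball_lt_top.ne) ?_ ?_
  · have h1 : ContinuousOn (D.Θ ∘ (extChartAt (𝓡 n) (g t) ∘ g)) (Metric.ball t ε) :=
      D.continuousOn_Θ.comp hK.continuousOn fun s hs => (hD s hs).2.1
    have h2 := (ContinuousLinearMap.id ℝ (EuclideanSpace ℝ (Fin n) →L[ℝ] V)).aestronglyMeasurable_comp₂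
      (h1.aestronglyMeasurable Metric.isOpen_ball.measurableSet (μ := volume))
      (aestronglyMeasurable_deriv (extChartAt (𝓡 n) (g t) ∘ g) _)
    refine h2.congr ?_
    filter_upwards [ae_restrict_mem Metric.isOpen_ball.measurableSet] with s hs
    exact (hD s hs).2.2.1.symm
  · filter_upwards [ae_restrict_mem Metric.isOpen_ball.measurableSet] with s hs
    exact (hD s hs).2.2.2

/-- Local existence of curves with prescribed velocity, on an interval of time which is uniform
near each point. -/
theorem exists_hasVelocityOn_ball [FiniteDimensional ℝ V] (θ : Coframing n M V) (p : M) (C : ℝ≥0) :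
    ∃ δ > 0, ∃ U ∈ 𝓝 p, ∀ q ∈ U, ∀ (t₀ : ℝ) (w : ℝ → V), AEStronglyMeasurable w →
      (∀ᵐ s, s ∈ Metric.ball t₀ δ → ‖w s‖ ≤ C) →
      ∃ g : ℝ → M, g t₀ = q ∧ θ.HasVelocityOn w (Metric.ball t₀ δ) g := by
  obtain ⟨D⟩ := θ.nonempty_chartData p
  set φ := extChartAt (𝓡 n) p with hφ
  obtain ⟨δ, hδ, hsol⟩ := exists_caratheodory_solution D.r_pos D.lip D.norm_F_le C
  refine ⟨δ, hδ, φ ⁻¹' Metric.closedBall (φ p) (D.r / 2) ∩ φ.source,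
    inter_mem ((continuousAt_extChartAt p) (Metric.closedBall_mem_nhds _ (half_pos D.r_pos)))
      (extChartAt_source_mem_nhds p), fun q hq t₀ w hwm hwC => ?_⟩
  obtain ⟨y, hy₀, ⟨K', hK'⟩, hyb, hy⟩ := hsol (φ q) hq.1 t₀ w hwm hwC
  have hcomp : φ ∘ (φ.symm ∘ y) = y := funext fun t => φ.right_inv (D.subset (hyb t))
  have hsrc : ∀ t, (φ.symm ∘ y) t ∈ φ.source := fun t => φ.map_target (D.subset (hyb t))
  have hsrc' : ∀ t, (φ.symm ∘ y) t ∈ (chartAt (EuclideanSpace ℝ (Fin n)) p).source := fun t => by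
    have := hsrc t
    rwa [hφ, extChartAt_source] at this
  have hcont : ∀ t, ContinuousAt (φ.symm ∘ y) t := fun t =>
    (continuousAt_extChartAt_symm'' (D.subset (hyb t))).comp hK'.continuous.continuousAt
  refine ⟨φ.symm ∘ y, ?_, fun t _ => ?_, ?_⟩
  · simp only [Function.comp_apply, hy₀, φ.left_inv hq.2]
  · refine LipschitzNear.of_chart (hcont t) (hsrc' t) ⟨K', univ, univ_mem, ?_⟩
    rw [← hφ, hcomp]
    exact hK'.lipschitzOnWith
  · filter_upwards [hy] with s hs hsb
    rw [D.form_velocity _ s (hcont s) (hsrc s), ← hφ, hcomp, (hs hsb).deriv]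
    have : φ ((φ.symm ∘ y) s) = y s := congrFun hcomp s
    rw [this, D.Θ_F _ (hyb s)]

end Coframing

end HasVelocity

/-! ### Uniqueness, gluing and change of parameter -/

section Uniqueness

variable {n : ℕ} {M : Type*} [TopologicalSpace M] [ChartedSpace (EuclideanSpace ℝ (Fin n)) M]
  [IsManifold (𝓡 n) ∞ M] {V : Type*} [NormedAddCommGroup V] [NormedSpace ℝ V]
  [FiniteDimensional ℝ V]

namespace Coframing

variable {θ : Coframing n M V} {w w' : ℝ → V} {I J : Set ℝ} {g g' : ℝ → M}

/-- The difference `z` of the two solutions in the chart satisfies `‖z'‖ ≤ D.K * ‖z‖ * C` and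
vanishes at `t`. On a ball of radius `ρ` with `D.K * C * ρ ≤ 1 / 2`, the maximum of `‖z‖` is at most
half of itself. -/
theorem HasVelocityOn.eventuallyEq (h : θ.HasVelocityOn w I g) (h' : θ.HasVelocityOn w I g')
    (hI : IsOpen I) {t : ℝ} (ht : t ∈ I) (heq : g t = g' t) : g =ᶠ[𝓝 t] g' := by
  obtain ⟨D⟩ := θ.nonempty_chartData (g t)
  obtain ⟨ε, hε, K, C, hsub, hK, hs, hw⟩ := h.exists_ball D hI ht rfl
  obtain ⟨ε', hε', K', C', hsub', hK', hs', hw'⟩ := h'.exists_ball D hI ht heq.symm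
  set φ := extChartAt (𝓡 n) (g t) with hφ
  obtain ⟨ρ, hρ, hρε, hρε', hρC⟩ : ∃ ρ > 0, ρ < ε ∧ ρ < ε' ∧ D.K * C * ρ ≤ 1 / 2 := by
    have h1 : Tendsto (fun ρ : ℝ => D.K * C * ρ) (𝓝 0) (𝓝 (D.K * C * 0)) :=
      Continuous.tendsto (by fun_prop) 0
    have h2 := (h1.eventually_lt_const (u := 1 / 2) (by simp)).and
      ((eventually_lt_nhds hε).and (eventually_lt_nhds hε'))
    obtain ⟨ρ, h3, hpos⟩ := ((h2.filter_mono nhdsWithin_le_nhds).and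
      (self_mem_nhdsWithin : Ioi (0 : ℝ) ∈ 𝓝[>] 0)).exists
    exact ⟨ρ, hpos, h3.2.1, h3.2.2, h3.1.le⟩
  have hb : Metric.closedBall t ρ ⊆ Metric.ball t ε := Metric.closedBall_subset_ball hρε
  have hb' : Metric.closedBall t ρ ⊆ Metric.ball t ε' := Metric.closedBall_subset_ball hρε'
  set z := fun s => (φ ∘ g) s - (φ ∘ g') s with hz
  have hzlip : LipschitzOnWith (K + K') z (Metric.closedBall t ρ) :=
    (hK.mono hb).sub (hK'.mono hb')
  obtain ⟨s₀, hs₀, hmax⟩ := (isCompact_closedBall t ρ).exists_isMaxOn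
    ⟨t, Metric.mem_closedBall_self hρ.le⟩ hzlip.continuousOn.norm
  have hzt : z t = 0 := by simp [hz, heq]
  have hle : ‖z s₀ - z t‖ ≤ (D.K * ‖z s₀‖ * C) * |s₀ - t| := by
    have huIcc : uIcc t s₀ ⊆ Metric.closedBall t ρ :=
      (convex_closedBall t ρ).ordConnected.uIcc_subset (Metric.mem_closedBall_self hρ.le) hs₀
    refine (hzlip.mono huIcc).norm_sub_le_of_ae_hasDerivAt ?_
    filter_upwards [hw, hw'] with s h1 h2 hss
    have hsρ := huIcc hss
    obtain ⟨hC, hd⟩ := h1 (hb hsρ)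
    obtain ⟨-, hd'⟩ := h2 (hb' hsρ)
    refine ⟨_, hd.sub hd', ?_⟩
    rw [← sub_apply]
    refine (ContinuousLinearMap.le_of_opNorm_le_of_le _ ?_ hC)
    refine (D.lip.norm_sub_le (hs s (hb hsρ)).2 (hs' s (hb' hsρ)).2).trans ?_
    gcongr
    exact hmax hsρ
  have hz0 : ‖z s₀‖ = 0 := by
    rw [hzt, sub_zero] at hle
    have h1 : |s₀ - t| ≤ ρ := by simpa [Real.dist_eq] using hs₀
    have h2 : D.K * ‖z s₀‖ * C * |s₀ - t| ≤ D.K * ‖z s₀‖ * C * ρ := by gcongr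
    have h3 : D.K * ‖z s₀‖ * C * ρ = ‖z s₀‖ * (D.K * C * ρ) := by ring
    have h4 : ‖z s₀‖ * (D.K * C * ρ) ≤ ‖z s₀‖ * (1 / 2) := by gcongr
    linarith [norm_nonneg (z s₀)]
  filter_upwards [Metric.closedBall_mem_nhds t hρ] with s hsρ
  have h1 : ‖z s‖ ≤ 0 := hz0 ▸ hmax hsρ
  have h2 : φ (g s) = φ (g' s) := sub_eq_zero.1 (norm_le_zero_iff.1 h1)
  exact φ.injOn (hs s (hb hsρ)).1 (hs' s (hb' hsρ)).1 h2

/-- The set of times where the germs agree is open, and it is closed in `I`: limits agree as `M` is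
Hausdorff, and then so do the germs by local uniqueness. -/
theorem HasVelocityOn.eqOn [T2Space M] (h : θ.HasVelocityOn w I g) (h' : θ.HasVelocityOn w I g')
    (hI : IsOpen I) (hc : IsPreconnected I) {t₀ : ℝ} (ht₀ : t₀ ∈ I) (heq : g t₀ = g' t₀) :
    EqOn g g' I := by
  have hsub : I ⊆ {t | g =ᶠ[𝓝 t] g'} := by
    refine hc.subset_of_closure_inter_subset ?_ ⟨t₀, ht₀, h.eventuallyEq h' hI ht₀ heq⟩ ?_
    · exact isOpen_iff_mem_nhds.2 fun t ht => eventually_eventually_nhds.2 ht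
    · rintro t ⟨hcl, ht⟩
      refine h.eventuallyEq h' hI ht ?_
      by_contra hne
      have h1 : ∀ᶠ s in 𝓝 t, g s ≠ g' s :=
        ((h.1 t ht).1.prodMk (h'.1 t ht).1).eventually
          ((isOpen_ne_fun continuous_fst continuous_snd).mem_nhds hne)
      obtain ⟨s, hs, hs'⟩ := mem_closure_iff_nhds.1 hcl _ h1
      exact hs (EventuallyEq.eq_of_nhds hs')
  exact fun t ht => EventuallyEq.eq_of_nhds (hsub ht)

/-- The union of two curves with the same prescribed velocity which agree at one time. -/
theorem HasVelocityOn.exists_union [T2Space M] (h : θ.HasVelocityOn w I g)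
    (h' : θ.HasVelocityOn w J g') (hI : IsOpen I) (hJ : IsOpen J) (hIJ : IsPreconnected (I ∩ J))
    {t₀ : ℝ} (ht₀ : t₀ ∈ I ∩ J) (heq : g t₀ = g' t₀) :
    ∃ f, EqOn f g I ∧ EqOn f g' J ∧ θ.HasVelocityOn w (I ∪ J) f := by
  classical
  have hagree : EqOn g g' (I ∩ J) := (h.mono inter_subset_left).eqOn (h'.mono inter_subset_right)
    (hI.inter hJ) hIJ ht₀ heq
  have h1 : EqOn (I.piecewise g g') g I := fun t ht => piecewise_eq_of_mem _ _ _ ht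
  have h2 : EqOn (I.piecewise g g') g' J := fun t ht => by
    by_cases hti : t ∈ I
    · rw [piecewise_eq_of_mem _ _ _ hti, hagree ⟨hti, ht⟩]
    · exact piecewise_eq_of_notMem _ _ _ hti
  refine ⟨I.piecewise g g', h1, h2, hasVelocityOn_of_forall_nhds fun t ht => ?_⟩
  rcases ht with ht | ht
  · exact ⟨I, hI.mem_nhds ht, h.congr hI h1⟩
  · exact ⟨J, hJ.mem_nhds ht, h'.congr hJ h2⟩

/-- Curves with prescribed velocity on the members of a family of intervals around `t₀`, all with
the same value at `t₀`, fit together. -/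
theorem exists_hasVelocityOn_sUnion [T2Space M] {S : Set (Set ℝ)} {t₀ : ℝ} {m : M}
    (hopen : ∀ I ∈ S, IsOpen I) (hord : ∀ I ∈ S, I.OrdConnected) (hmem : ∀ I ∈ S, t₀ ∈ I)
    (hS : ∀ I ∈ S, ∃ g : ℝ → M, g t₀ = m ∧ θ.HasVelocityOn w I g) :
    ∃ g : ℝ → M, g t₀ = m ∧ θ.HasVelocityOn w (⋃₀ S) g := by
  classical
  have : Nonempty M := ⟨m⟩
  choose! G hG0 hG using hS
  have hagree : ∀ I ∈ S, ∀ J ∈ S, ∀ t ∈ I ∩ J, G I t = G J t := fun I hI J hJ t ht =>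
    ((hG I hI).mono inter_subset_left).eqOn ((hG J hJ).mono inter_subset_right)
      ((hopen I hI).inter (hopen J hJ)) ((hord I hI).inter (hord J hJ)).isPreconnected
      ⟨hmem I hI, hmem J hJ⟩ ((hG0 I hI).trans (hG0 J hJ).symm) ht
  let g : ℝ → M := fun t => if h : ∃ I ∈ S, t ∈ I then G h.choose t else m
  have hg : ∀ I ∈ S, EqOn g (G I) I := fun I hI t ht => by
    have h : ∃ I ∈ S, t ∈ I := ⟨I, hI, ht⟩
    simp only [g, dif_pos h]
    exact hagree _ h.choose_spec.1 _ hI t ⟨h.choose_spec.2, ht⟩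
  refine ⟨g, ?_, hasVelocityOn_of_forall_nhds fun t ⟨I, hI, ht⟩ =>
    ⟨I, (hopen I hI).mem_nhds ht, (hG I hI).congr (hopen I hI) (hg I hI)⟩⟩
  by_cases h : ∃ I, I ∈ S
  · obtain ⟨I, hI⟩ := h
    rw [hg I hI (hmem I hI), hG0 I hI]
  · have : ¬ ∃ I ∈ S, t₀ ∈ I := fun ⟨I, hI, _⟩ => h ⟨I, hI⟩
    simp only [g, dif_neg this]

/-- Velocities transform by the chain rule under Lipschitz changes of parameter. -/
theorem HasVelocityOn.comp {h : ℝ → ℝ} {K : ℝ≥0} (hg : θ.HasVelocityOn w I g) (hI : IsOpen I)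
    (hK : LipschitzWith K h) (hinj : Function.Injective h) :
    θ.HasVelocityOn (fun s => deriv h s • w (h s)) (h ⁻¹' I) (g ∘ h) := by
  have hlip : ∀ t ∈ h ⁻¹' I, LipschitzNear n (g ∘ h) t := fun t ht => (hg.1 (h t) ht).comp hK
  refine ⟨hlip, ?_⟩
  have hae : ∀ᵐ s, s ∈ I → θ.form (g s) (velocity n g s) = w s ∧
      MDifferentiableAt 𝓘(ℝ, ℝ) (𝓡 n) g s := by
    filter_upwards [hg.2, ae_mdifferentiableAt_of_lipschitzNear θ hI hg.1] with s h1 h2 hs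
    exact ⟨h1 hs, h2 hs⟩
  filter_upwards [ae_hasDerivAt_zero_of_injective hK hinj hae, hK.ae_differentiableAt_real]
    with s hs hd hsI
  have hc := (hg.1 (h s) hsI).1
  have hsrc : g (h s) ∈ (chartAt (EuclideanSpace ℝ (Fin n)) (g (h s))).source := mem_chart_source _ _
  have e1 := θ.form_velocity (g := g ∘ h) (s := s) (p := g (h s)) (hlip s hsI).1 hsrc
  rw [Function.comp_apply] at e1
  rw [Function.comp_apply, e1]
  rcases hs with hs | hs
  · obtain ⟨h1, h2⟩ := hs hsI
    have hdiff := (mdifferentiableAt_curve_iff hc hsrc).1 h2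
    rw [← h1, θ.form_velocity hc hsrc, ← map_smul]
    congr 1
    exact (hdiff.hasDerivAt.scomp s hd.hasDerivAt).deriv
  -- Here `h s` may be an exceptional time of `g`, but `h` has derivative `0` at `s`; since `g` is
  -- Lipschitz near `h s`, so does `g ∘ h` in the chart.
  · rw [hs.deriv, zero_smul]
    obtain ⟨-, K', u, hu, hK'⟩ := hg.1 (h s) hsI
    have : HasDerivAt (extChartAt (𝓡 n) (g (h s)) ∘ (g ∘ h)) 0 s := by
      rw [hasDerivAt_iff_isLittleO] at hs ⊢
      simp only [smul_zero, sub_zero] at hs ⊢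
      refine Asymptotics.IsBigO.trans_isLittleO ?_ hs
      refine Asymptotics.IsBigO.of_bound K' ?_
      filter_upwards [hK.continuous.continuousAt hu] with r hr
      exact hK'.norm_sub_le hr (mem_of_mem_nhds hu)
    rw [this.deriv, map_zero]

end Coframing

end Uniqueness

/-! ### The distance of a canonical metric -/

section Distance

theorem IsInnerProduct.exists_sqrt_le {V : Type*} [NormedAddCommGroup V] [NormedSpace ℝ V]
    (B : V →L[ℝ] V →L[ℝ] ℝ) : ∃ c : ℝ≥0, ∀ v, √(B v v) ≤ c * ‖v‖ := by
  refine ⟨(√‖B‖).toNNReal, fun v => ?_⟩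
  rw [Real.coe_toNNReal _ (Real.sqrt_nonneg _), Real.sqrt_le_iff]
  refine ⟨by positivity, ?_⟩
  have h : √‖B‖ ^ 2 = ‖B‖ := Real.sq_sqrt (by positivity)
  rw [mul_pow, h, sq, ← mul_assoc]
  exact (le_abs_self _).trans (B.le_opNorm₂ v v)

theorem IsInnerProduct.exists_le_sqrt {V : Type*} [NormedAddCommGroup V] [NormedSpace ℝ V]
    [FiniteDimensional ℝ V] {B : V →L[ℝ] V →L[ℝ] ℝ} (hB : IsInnerProduct B) :
    ∃ c : ℝ≥0, 0 < c ∧ ∀ v, ‖v‖ ≤ c * √(B v v) := by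
  have h := hB.isVonNBounded
  rw [NormedSpace.isVonNBounded_iff, isBounded_iff_forall_norm_le] at h
  obtain ⟨R, hR⟩ := h
  have hR0 : 0 ≤ R := by simpa using hR 0 (by simp)
  refine ⟨(2 * R + 1).toNNReal, Real.toNNReal_pos.2 (by positivity), fun v => ?_⟩
  rw [Real.coe_toNNReal _ (by positivity)]
  rcases eq_or_ne v 0 with rfl | hv
  · simp
  have hpos := hB.pos v hv
  set b := √(B v v) with hb
  have hb0 : 0 < b := Real.sqrt_pos.2 hpos
  have hbb : B v v = b * b := (Real.mul_self_sqrt hpos.le).symm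
  -- The factor 2 gives the rescaled vector the `B`-square `1 / 4`, inside the open unit ball that
  -- `R` bounds.
  have h1 : ‖(2 * b)⁻¹ • v‖ ≤ R := by
    apply hR
    simp only [mem_ofPred_eq, map_smul, smul_apply, smul_eq_mul, hbb]
    field_simp
    norm_num
  rw [norm_smul, norm_inv, Real.norm_of_nonneg (by positivity), inv_mul_le_iff₀ (by positivity)]
    at h1
  nlinarith

variable {n : ℕ} {M : Type*} [TopologicalSpace M] [ChartedSpace (EuclideanSpace ℝ (Fin n)) M]
  [IsManifold (𝓡 n) ∞ M] {V : Type*} [NormedAddCommGroup V] [NormedSpace ℝ V]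

namespace Coframing

open Bundle Manifold

/-- The Riemannian distance of a canonical metric. -/
noncomputable def edist (θ : Coframing n M V) {B : V →L[ℝ] V →L[ℝ] ℝ} (hB : IsInnerProduct B)
    (x y : M) : ℝ≥0∞ :=
  letI : RiemannianBundle (fun m : M => TangentSpace (𝓡 n) m) :=
    ⟨(θ.canonicalMetric B hB).toRiemannianMetric⟩
  Manifold.riemannianEDist (𝓡 n) x y

variable (θ : Coframing n M V) {B : V →L[ℝ] V →L[ℝ] ℝ} (hB : IsInnerProduct B)

theorem isCompleteMetric_iff : IsCompleteMetric (θ.canonicalMetric B hB) ↔ ∀ x : ℕ → M,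
    (∀ ε : ℝ≥0∞, 0 < ε → ∃ N, ∀ i ≥ N, ∀ j ≥ N, θ.edist hB (x i) (x j) < ε) →
    ∃ y : M, Tendsto (fun i => θ.edist hB (x i) y) atTop (𝓝 0) :=
  Iff.rfl

theorem edist_comm (x y : M) : θ.edist hB x y = θ.edist hB y x := by
  let : RiemannianBundle (fun m : M => TangentSpace (𝓡 n) m) :=
    ⟨(θ.canonicalMetric B hB).toRiemannianMetric⟩
  exact riemannianEDist_comm

theorem edist_self (x : M) : θ.edist hB x x = 0 := by
  let : RiemannianBundle (fun m : M => TangentSpace (𝓡 n) m) :=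
    ⟨(θ.canonicalMetric B hB).toRiemannianMetric⟩
  exact riemannianEDist_self

theorem edist_triangle (x y z : M) : θ.edist hB x z ≤ θ.edist hB x y + θ.edist hB y z := by
  have : IsManifold (𝓡 n) 1 M := IsManifold.of_le (n := ∞) (by norm_cast)
  let : RiemannianBundle (fun m : M => TangentSpace (𝓡 n) m) :=
    ⟨(θ.canonicalMetric B hB).toRiemannianMetric⟩
  exact riemannianEDist_triangle

theorem eventually_edist_lt (x : M) {c : ℝ≥0∞} (hc : 0 < c) :
    ∀ᶠ y in 𝓝 x, θ.edist hB x y < c := by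
  have : IsManifold (𝓡 n) 1 M := IsManifold.of_le (n := ∞) (by norm_cast)
  let : RiemannianBundle (fun m : M => TangentSpace (𝓡 n) m) :=
    ⟨(θ.canonicalMetric B hB).toRiemannianMetric⟩
  have : IsContinuousRiemannianBundle (EuclideanSpace ℝ (Fin n))
      (fun m : M => TangentSpace (𝓡 n) m) :=
    ⟨⟨(θ.canonicalMetric B hB).inner, (θ.canonicalMetric B hB).contMDiff.continuous,
      fun _ _ _ => rfl⟩⟩
  exact eventually_riemannianEDist_lt (𝓡 n) x hc

theorem exists_edist_lt_subset [RegularSpace M] {x : M} {s : Set M} (hs : s ∈ 𝓝 x) :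
    ∃ c > 0, {y | θ.edist hB x y < c} ⊆ s := by
  have : IsManifold (𝓡 n) 1 M := IsManifold.of_le (n := ∞) (by norm_cast)
  let : RiemannianBundle (fun m : M => TangentSpace (𝓡 n) m) :=
    ⟨(θ.canonicalMetric B hB).toRiemannianMetric⟩
  have : IsContinuousRiemannianBundle (EuclideanSpace ℝ (Fin n))
      (fun m : M => TangentSpace (𝓡 n) m) :=
    ⟨⟨(θ.canonicalMetric B hB).inner, (θ.canonicalMetric B hB).contMDiff.continuous,
      fun _ _ _ => rfl⟩⟩
  exact setOfPred_riemannianEDist_lt_subset_nhds' (𝓡 n) hs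

theorem pathELength_eq (γ : ℝ → M) (a b : ℝ) :
    letI : RiemannianBundle (fun m : M => TangentSpace (𝓡 n) m) :=
      ⟨(θ.canonicalMetric B hB).toRiemannianMetric⟩
    pathELength (𝓡 n) γ a b = ∫⁻ t in Ioo a b, ENNReal.ofReal
      √(B (θ.form (γ t) (velocity n γ t)) (θ.form (γ t) (velocity n γ t))) := by
  let : RiemannianBundle (fun m : M => TangentSpace (𝓡 n) m) :=
    ⟨(θ.canonicalMetric B hB).toRiemannianMetric⟩
  rw [pathELength_eq_lintegral_mfderiv_Ioo]
  refine lintegral_congr fun t => ?_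
  rw [← ofReal_norm, norm_eq_sqrt_real_inner]
  rfl

theorem edist_le_lintegral {γ : ℝ → M} {a b : ℝ} (hab : a ≤ b)
    (hγ : ContMDiffOn 𝓘(ℝ, ℝ) (𝓡 n) 1 γ (Icc a b)) :
    θ.edist hB (γ a) (γ b) ≤ ∫⁻ t in Ioo a b, ENNReal.ofReal
      √(B (θ.form (γ t) (velocity n γ t)) (θ.form (γ t) (velocity n γ t))) := by
  let : RiemannianBundle (fun m : M => TangentSpace (𝓡 n) m) :=
    ⟨(θ.canonicalMetric B hB).toRiemannianMetric⟩
  have h1 := riemannianEDist_le_pathELength (I := 𝓡 n) hγ rfl rfl hab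
  have h2 := θ.pathELength_eq hB γ a b
  exact h1.trans h2.le

/-- The path is `C¹` on all of `ℝ`, beyond its endpoints too, so that it is a locally Lipschitz
curve. -/
theorem exists_path_of_edist_lt {x y : M} {r : ℝ≥0∞} (h : θ.edist hB x y < r)
    {a b : ℝ} (hab : a < b) :
    ∃ γ : ℝ → M, γ a = x ∧ γ b = y ∧ ContMDiff 𝓘(ℝ, ℝ) (𝓡 n) 1 γ ∧
      ∫⁻ t in Ioo a b, ENNReal.ofReal
        √(B (θ.form (γ t) (velocity n γ t)) (θ.form (γ t) (velocity n γ t))) < r := by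
  have : IsManifold (𝓡 n) 1 M := IsManifold.of_le (n := ∞) (by norm_cast)
  let : RiemannianBundle (fun m : M => TangentSpace (𝓡 n) m) :=
    ⟨(θ.canonicalMetric B hB).toRiemannianMetric⟩
  obtain ⟨γ, h0, h1, hγ, hr, -⟩ :=
    exists_lt_locally_constant_of_riemannianEDist_lt (I := 𝓡 n) h hab
  have h2 := θ.pathELength_eq hB γ a b
  exact ⟨γ, h0, h1, hγ, h2 ▸ hr⟩

/-- The straight segment stays in the convex chart ball, and its length is measured by the frozen
map `Θ` at the centre at the cost of a factor 2. This factor is the same for all charts, which makes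
Lipschitz constants uniform along a curve. -/
theorem ChartData.edist_le {p : M} (D : θ.ChartData p) {c : ℝ≥0}
    (hc : ∀ v, √(B v v) ≤ c * ‖v‖) {q q' : M}
    (hq : q ∈ (extChartAt (𝓡 n) p).source) (hq' : q' ∈ (extChartAt (𝓡 n) p).source)
    (hqb : extChartAt (𝓡 n) p q ∈ Metric.closedBall (extChartAt (𝓡 n) p p) D.r)
    (hqb' : extChartAt (𝓡 n) p q' ∈ Metric.closedBall (extChartAt (𝓡 n) p p) D.r) :
    θ.edist hB q q' ≤ ENNReal.ofReal
      (2 * c * ‖D.Θ (extChartAt (𝓡 n) p p) (extChartAt (𝓡 n) p q' - extChartAt (𝓡 n) p q)‖) := by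
  set φ := extChartAt (𝓡 n) p with hφ
  let η : ℝ → EuclideanSpace ℝ (Fin n) := fun t => φ q + t • (φ q' - φ q)
  have hη : ∀ t, HasDerivAt η (φ q' - φ q) t := fun t => by
    have := ((hasDerivAt_id t).smul_const (φ q' - φ q)).const_add (φ q)
    rwa [one_smul] at this
  have hηs : ContDiff ℝ 1 η := by fun_prop
  have hηb : ∀ t ∈ Icc (0 : ℝ) 1, η t ∈ Metric.closedBall (φ p) D.r := fun t ht =>
    (convex_closedBall _ _).add_smul_sub_mem hqb hqb' ht
  have hγ : ContMDiffOn 𝓘(ℝ, ℝ) (𝓡 n) 1 (φ.symm ∘ η) (Icc 0 1) := by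
    have : IsManifold (𝓡 n) 1 M := IsManifold.of_le (n := ∞) (by norm_cast)
    exact (contMDiffOn_extChartAt_symm p).comp hηs.contMDiff.contMDiffOn
      fun t ht => D.subset (hηb t ht)
  have h := θ.edist_le_lintegral hB zero_le_one hγ
  have e0 : (φ.symm ∘ η) 0 = q := by simp [η, φ.left_inv hq]
  have e1 : (φ.symm ∘ η) 1 = q' := by simp [η, φ.left_inv hq']
  rw [e0, e1] at h
  refine h.trans ?_
  calc _ ≤ ∫⁻ t in Ioo (0 : ℝ) 1, ENNReal.ofReal (2 * c * ‖D.Θ (φ p) (φ q' - φ q)‖) := by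
        refine setLIntegral_mono' measurableSet_Ioo fun t ht => ENNReal.ofReal_le_ofReal ?_
        refine (hc _).trans ?_
        have htb := hηb t ⟨ht.1.le, ht.2.le⟩
        have hφη : φ ((φ.symm ∘ η) t) = η t := φ.right_inv (D.subset htb)
        have hev : φ ∘ (φ.symm ∘ η) =ᶠ[𝓝 t] η := by
          filter_upwards [Ioo_mem_nhds ht.1 ht.2] with s hs
          exact φ.right_inv (D.subset (hηb s ⟨hs.1.le, hs.2.le⟩))
        rw [D.form_velocity _ t ((continuousAt_extChartAt_symm'' (D.subset htb)).comp
          (hη t).continuousAt) (φ.map_target (D.subset htb)), ← hφ, hφη, hev.deriv_eq, (hη t).deriv]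
        have := D.norm_Θ_le _ htb (φ q' - φ q)
        nlinarith [c.2]
    _ = _ := by simp

end Coframing

end Distance

/-! ### Global existence for complete metrics -/

section Existence

variable {n : ℕ} {M : Type*} [TopologicalSpace M] [ChartedSpace (EuclideanSpace ℝ (Fin n)) M]
  [IsManifold (𝓡 n) ∞ M] {V : Type*} [NormedAddCommGroup V] [NormedSpace ℝ V]
  [FiniteDimensional ℝ V]

namespace Coframing

variable {θ : Coframing n M V} {B : V →L[ℝ] V →L[ℝ] ℝ} (hB : IsInnerProduct B)
  {w : ℝ → V} {I : Set ℝ} {g : ℝ → M}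

/-- One factor 2 is that of `ChartData.edist_le`, the other comes from comparing `Θ` at the centre
with `Θ` along the curve. Only `ε` depends on `t`. -/
theorem HasVelocityOn.exists_ball_edist_le (h : θ.HasVelocityOn w I g) (hI : IsOpen I) {c : ℝ≥0}
    (hc : ∀ v, √(B v v) ≤ c * ‖v‖) {C : ℝ≥0} (hC : ∀ᵐ s, s ∈ I → ‖w s‖ ≤ C) {t : ℝ} (ht : t ∈ I) :
    ∃ ε > 0, ∀ s ∈ Metric.ball t ε, ∀ s' ∈ Metric.ball t ε,
      θ.edist hB (g s) (g s') ≤ ENNReal.ofReal (4 * c * C * |s' - s|) := by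
  obtain ⟨D⟩ := θ.nonempty_chartData (g t)
  obtain ⟨ε, hε, K, _, hsub, hK, hb, hd⟩ := h.exists_ball D hI ht rfl
  set φ := extChartAt (𝓡 n) (g t) with hφ
  refine ⟨ε, hε, fun s hs s' hs' => ?_⟩
  refine (D.edist_le θ hB hc (hb s hs).1 (hb s' hs').1 (hb s hs).2 (hb s' hs').2).trans
    (ENNReal.ofReal_le_ofReal ?_)
  have hu : uIcc s s' ⊆ Metric.ball t ε :=
    (convex_ball t ε).ordConnected.uIcc_subset hs hs'
  have hlip : LipschitzOnWith (‖D.Θ (φ (g t))‖₊ * K) (D.Θ (φ (g t)) ∘ (φ ∘ g)) (uIcc s s') :=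
    (D.Θ (φ (g t))).lipschitz.comp_lipschitzOnWith (hK.mono hu)
  have key : ‖(D.Θ (φ (g t)) ∘ (φ ∘ g)) s' - (D.Θ (φ (g t)) ∘ (φ ∘ g)) s‖ ≤ 2 * C * |s' - s| := by
    refine hlip.norm_sub_le_of_ae_hasDerivAt ?_
    filter_upwards [hd, hC] with r h1 h2 hr
    obtain ⟨-, h3⟩ := h1 (hu hr)
    refine ⟨_, (D.Θ (φ (g t))).hasFDerivAt.comp_hasDerivAt r h3, ?_⟩
    have h4 := D.le_norm_Θ _ (hb r (hu hr)).2 (D.F (φ (g r)) (w r))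
    rw [D.Θ_F _ (hb r (hu hr)).2] at h4
    exact h4.trans (by gcongr; exact h2 (hsub (hu hr)))
  simp only [Function.comp_apply, ← map_sub] at key
  calc _ ≤ 2 * c * (2 * C * |s' - s|) := by gcongr
    _ = _ := by ring

/-- The local bounds share one constant, so they add up along `Icc a b` by continuous induction. -/
theorem HasVelocityOn.edist_le (h : θ.HasVelocityOn w I g) (hI : IsOpen I) (hord : I.OrdConnected)
    {c : ℝ≥0} (hc : ∀ v, √(B v v) ≤ c * ‖v‖) {C : ℝ≥0} (hC : ∀ᵐ s, s ∈ I → ‖w s‖ ≤ C)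
    {a b : ℝ} (ha : a ∈ I) (hb : b ∈ I) :
    θ.edist hB (g a) (g b) ≤ ENNReal.ofReal (4 * c * C * |b - a|) := by
  wlog hab : a ≤ b generalizing a b
  · rw [θ.edist_comm hB, abs_sub_comm]
    exact this hb ha (not_le.1 hab).le
  set L : ℝ := 4 * c * C with hL
  have hL0 : 0 ≤ L := by positivity
  set S := {t : ℝ | θ.edist hB (g a) (g t) ≤ ENNReal.ofReal (L * (t - a))} with hS
  have hIcc : Icc a b ⊆ I := hord.out ha hb
  have hloc := fun t ht => h.exists_ball_edist_le hB hI hc hC (t := t) (hIcc ht)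
  have hsub : Icc a b ⊆ S := by
    refine IsClosed.Icc_subset_of_forall_exists_gt ?_ ?_ ?_
    · refine isClosed_of_closure_subset fun x hx => ?_
      have hxI : x ∈ Icc a b :=
        closure_minimal inter_subset_right isClosed_Icc hx
      refine ⟨?_, hxI⟩
      obtain ⟨ε, hε, hball⟩ := hloc x hxI
      -- The time `t` approximating `x` may lie after it; this costs at most `2 * L * η`, and `η`
      -- tends to `0`.
      have hlim : Tendsto (fun η : ℝ => ENNReal.ofReal (L * (x - a) + 2 * L * η)) (𝓝[>] 0)
          (𝓝 (ENNReal.ofReal (L * (x - a) + 2 * L * 0))) :=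
        (Continuous.tendsto (ENNReal.continuous_ofReal.comp (by fun_prop)) 0).mono_left nhdsWithin_le_nhds
      rw [mul_zero, add_zero] at hlim
      refine ge_of_tendsto hlim ?_
      filter_upwards [self_mem_nhdsWithin, nhdsWithin_le_nhds (eventually_lt_nhds hε)]
        with η hη hηε
      obtain ⟨t, htb, htS, htI⟩ := mem_closure_iff_nhds.1 hx _ (Metric.ball_mem_nhds x hη)
      refine (θ.edist_triangle hB (g a) (g t) (g x)).trans ?_
      have h1 := hball t (Metric.ball_subset_ball hηε.le htb) x (Metric.mem_ball_self hε)
      have htx : |t - x| < η := by simpa [Real.dist_eq] using htb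
      have htx' := abs_lt.1 htx
      refine (add_le_add htS h1).trans ?_
      rw [← ENNReal.ofReal_add (mul_nonneg hL0 (by linarith [htI.1])) (by positivity)]
      refine ENNReal.ofReal_le_ofReal ?_
      rw [abs_sub_comm] at htx
      have h2 : L * |x - t| ≤ L * η := by gcongr
      have h3 : L * (t - a) ≤ L * (x - a + η) := by gcongr; linarith
      nlinarith
    · simp [hS, θ.edist_self hB]
    · rintro x ⟨hxS, hxI⟩ y hy
      obtain ⟨ε, hε, hball⟩ := hloc x ⟨hxI.1, hxI.2.le⟩
      obtain ⟨t, ht, ht'⟩ := exists_between (lt_min (show x < y from hy) (show x < x + ε by linarith))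
      refine ⟨t, ?_, ht, ht'.le.trans (min_le_left _ _)⟩
      have htb : t ∈ Metric.ball x ε := by
        rw [Metric.mem_ball, Real.dist_eq, abs_of_pos (by linarith)]
        linarith [min_le_right y (x + ε)]
      refine (θ.edist_triangle hB (g a) (g x) (g t)).trans ?_
      refine (add_le_add hxS (hball x (Metric.mem_ball_self hε) t htb)).trans ?_
      rw [← ENNReal.ofReal_add (mul_nonneg hL0 (by linarith [hxI.1])) (by positivity),
        abs_of_pos (by linarith)]
      exact ENNReal.ofReal_le_ofReal (by linarith)
  have := hsub ⟨hab, le_rfl⟩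
  rwa [abs_of_nonneg (by linarith)]

/-- Truncating `w` outside the ball around `T` bounds it everywhere, so that `δ` does not shrink as
`t₀` nears the boundary of that ball. -/
theorem exists_hasVelocityOn_of_ball (θ : Coframing n M V) (hw : AEStronglyMeasurable w) {T ε : ℝ}
    {C : ℝ≥0} (hC : ∀ᵐ s, s ∈ Metric.ball T ε → ‖w s‖ ≤ C) (p : M) :
    ∃ δ > 0, ∃ U ∈ 𝓝 p, ∀ q ∈ U, ∀ t₀ : ℝ,
      ∃ g : ℝ → M, g t₀ = q ∧ θ.HasVelocityOn w (Metric.ball t₀ δ ∩ Metric.ball T ε) g := by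
  obtain ⟨δ, hδ, U, hU, hex⟩ := θ.exists_hasVelocityOn_ball p C
  refine ⟨δ, hδ, U, hU, fun q hq t₀ => ?_⟩
  obtain ⟨g, hg0, hg⟩ := hex q hq t₀ ((Metric.ball T ε).indicator w)
    (hw.indicator Metric.isOpen_ball.measurableSet) (by
      filter_upwards [hC] with s hs _
      by_cases h : s ∈ Metric.ball T ε
      · rw [indicator_of_mem h]; exact hs h
      · rw [indicator_of_notMem h, norm_zero]; exact C.2)
  exact ⟨g, hg0, (hg.mono inter_subset_left).congr_ae
    (Eventually.of_forall fun s hs => indicator_of_mem hs.2 w)⟩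

/-- For a complete canonical metric, there are curves on the whole real line with any locally
bounded prescribed velocity. -/
theorem exists_hasVelocityOn_univ [T2Space M] (hcomp : IsCompleteMetric (θ.canonicalMetric B hB))
    (hw : AEStronglyMeasurable w)
    (hloc : ∀ T : ℝ, ∃ C : ℝ≥0, ∃ ε > 0, ∀ᵐ s, s ∈ Metric.ball T ε → ‖w s‖ ≤ C) (t₀ : ℝ) (m : M) :
    ∃ g : ℝ → M, g t₀ = m ∧ θ.HasVelocityOn w univ g := by
  have : LocallyCompactSpace M := Manifold.locallyCompact_of_finiteDimensional (𝓡 n)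
  set S : Set (Set ℝ) := {I | IsOpen I ∧ I.OrdConnected ∧ t₀ ∈ I ∧
    ∃ g : ℝ → M, g t₀ = m ∧ θ.HasVelocityOn w I g} with hS
  obtain ⟨g, hg0, hg⟩ := exists_hasVelocityOn_sUnion (S := S) (t₀ := t₀) (m := m) (w := w) (θ := θ)
    (fun I hI => hI.1) (fun I hI => hI.2.1) (fun I hI => hI.2.2.1) (fun I hI => hI.2.2.2)
  set J := ⋃₀ S with hJ
  have hJo : IsOpen J := isOpen_sUnion fun I hI => hI.1
  have hJc : J.OrdConnected :=
    (isPreconnected_sUnion t₀ S (fun I hI => hI.2.2.1) fun I hI => hI.2.1.isPreconnected).ordConnected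
  have ht₀ : t₀ ∈ J := by
    obtain ⟨C, ε, hε, hC⟩ := hloc t₀
    obtain ⟨δ, hδ, U, hU, hex⟩ := θ.exists_hasVelocityOn_of_ball hw hC m
    obtain ⟨g', hg', hv⟩ := hex m (mem_of_mem_nhds hU) t₀
    exact ⟨_, ⟨Metric.isOpen_ball.inter Metric.isOpen_ball,
      (convex_ball _ _).ordConnected.inter (convex_ball _ _).ordConnected,
      ⟨Metric.mem_ball_self hδ, Metric.mem_ball_self hε⟩, g', hg', hv⟩,
      Metric.mem_ball_self hδ, Metric.mem_ball_self hε⟩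
  suffices J = univ from ⟨g, hg0, this ▸ hg⟩
  by_contra hne
  obtain ⟨T, hT⟩ := nonempty_frontier_iff.2 ⟨⟨t₀, ht₀⟩, hne⟩
  rw [hJo.frontier_eq] at hT
  obtain ⟨C, ε, hε, hC⟩ := hloc T
  obtain ⟨c, hc⟩ := IsInnerProduct.exists_sqrt_le B
  have hTcl : T ∈ closure (Metric.ball T ε ∩ J) :=
    Metric.isOpen_ball.inter_closure ⟨Metric.mem_ball_self hε, hT.1⟩
  -- Times in the maximal interval `J` tending to its endpoint `T`; along them the curve is Cauchy
  -- by the Lipschitz bound.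
  obtain ⟨t, htJ, htT⟩ := mem_closure_iff_seq_limit.1 hTcl
  have hdist : ∀ i j, θ.edist hB (g (t i)) (g (t j)) ≤
      ENNReal.ofReal (4 * c * C * |t j - t i|) := fun i j =>
    (hg.mono inter_subset_right).edist_le hB (Metric.isOpen_ball.inter hJo)
      ((convex_ball _ _).ordConnected.inter hJc) hc
      (hC.mono fun s hs hs' => hs hs'.1) (htJ i) (htJ j)
  obtain ⟨y, hy⟩ := (θ.isCompleteMetric_iff hB).1 hcomp (fun i => g (t i)) (by
    intro η hη
    have h1 : Tendsto (fun x : ℝ × ℝ => ENNReal.ofReal (4 * c * C * |x.2 - x.1|)) (𝓝 (T, T))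
        (𝓝 (ENNReal.ofReal (4 * c * C * |(T, T).2 - (T, T).1|))) :=
      Continuous.tendsto (ENNReal.continuous_ofReal.comp (by fun_prop)) _
    rw [sub_self, abs_zero, mul_zero, ENNReal.ofReal_zero, nhds_prod_eq] at h1
    have h2 := h1.comp (htT.prodMap htT)
    rw [prod_atTop_atTop_eq] at h2
    obtain ⟨⟨N₁, N₂⟩, hN⟩ := eventually_atTop.1 (h2.eventually_lt_const hη)
    refine ⟨max N₁ N₂, fun i hi j hj => (hdist i j).trans_lt (hN (i, j) ⟨?_, ?_⟩)⟩
    exacts [(le_max_left _ _).trans hi, (le_max_right _ _).trans hj])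
  -- Restart from `g (t i)`, for `i` so large that this point is in `U` and `T` is less than `δ`
  -- away from `t i`. The glued curve passes `T`, against maximality of `J`.
  obtain ⟨δ, hδ, U, hU, hex⟩ := θ.exists_hasVelocityOn_of_ball hw hC y
  obtain ⟨e, he, hsub⟩ := θ.exists_edist_lt_subset hB hU
  obtain ⟨i, hi1, hi2⟩ := ((hy.eventually_lt_const he).and
    (htT.eventually (Metric.ball_mem_nhds T hδ))).exists
  obtain ⟨g', hg', hv⟩ := hex (g (t i)) (hsub (by rw [mem_ofPred_eq, θ.edist_comm hB]; exact hi1)) (t i)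
  set J' := Metric.ball (t i) δ ∩ Metric.ball T ε with hJ'
  have hJ'o : IsOpen J' := Metric.isOpen_ball.inter Metric.isOpen_ball
  have hJ'c : J'.OrdConnected := (convex_ball _ _).ordConnected.inter (convex_ball _ _).ordConnected
  have hti : t i ∈ J ∩ J' := ⟨(htJ i).2, Metric.mem_ball_self hδ, (htJ i).1⟩
  have hTJ' : T ∈ J' := ⟨by rwa [Metric.mem_ball_comm], Metric.mem_ball_self hε⟩
  obtain ⟨f, hf1, hf2, hf⟩ := hg.exists_union hv hJo hJ'o (hJc.inter hJ'c).isPreconnected hti hg'.symm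
  refine hT.2 ⟨J ∪ J', ⟨hJo.union hJ'o, ?_, Or.inl ht₀, f, (hf1 ht₀).trans hg0, hf⟩, Or.inr hTJ'⟩
  exact (hJc.isPreconnected.union (t i) hti.1 hti.2 hJ'c.isPreconnected).ordConnected

end Coframing

end Existence

/-! ### Lipschitz parametrizations of rectifiable curves -/

section Reparametrization

/-- The inverse of the increasing homeomorphism `t ↦ t + L t`. -/
theorem exists_orderIso_add {L : ℝ → ℝ} (hL : Continuous L) (hmono : Monotone L) :
    ∃ h : ℝ ≃o ℝ, (∀ τ, h τ + L (h τ) = τ) ∧ LipschitzWith 1 h ∧ LipschitzWith 1 (L ∘ h) := by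
  have hstrict : StrictMono fun t => t + L t := strictMono_id.add_monotone hmono
  have hsurj : Function.Surjective fun t => t + L t := by
    refine (continuous_id.add hL).surjective ?_ ?_
    · refine tendsto_atTop_mono' atTop ?_ (tendsto_atTop_add_const_right atTop (L 0) tendsto_id)
      filter_upwards [eventually_ge_atTop 0] with t ht
      exact add_le_add le_rfl (hmono ht)
    · refine tendsto_atBot_mono' atBot ?_ (tendsto_atBot_add_const_right atBot (L 0) tendsto_id)
      filter_upwards [eventually_le_atBot 0] with t ht
      exact add_le_add le_rfl (hmono ht)
  let k := hstrict.orderIsoOfSurjective _ hsurj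
  have hk : ∀ τ, k.symm τ + L (k.symm τ) = τ := fun τ => k.apply_symm_apply τ
  -- The increments of `k.symm` and of `L ∘ k.symm` have the same sign and add up to that of the
  -- identity, so neither exceeds it.
  have key : ∀ σ τ, σ ≤ τ → k.symm σ ≤ k.symm τ ∧ L (k.symm σ) ≤ L (k.symm τ) := fun σ τ hστ =>
    ⟨k.symm.monotone hστ, hmono (k.symm.monotone hστ)⟩
  refine ⟨k.symm, hk, LipschitzWith.of_dist_le_mul fun σ τ => ?_,
    LipschitzWith.of_dist_le_mul fun σ τ => ?_⟩
  all_goals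
    simp only [Real.dist_eq, NNReal.coe_one, one_mul, Function.comp_apply]
    rcases le_total σ τ with hστ | hστ
    · have := key σ τ hστ
      rw [abs_of_nonpos (by linarith), abs_of_nonpos (by linarith)]
      linarith [hk σ, hk τ]
    · have := key τ σ hστ
      rw [abs_of_nonneg (by linarith), abs_of_nonneg (by linarith)]
      linarith [hk σ, hk τ]

/-- `L` is the variation of `f` up to time `t`, continuous because `f` is, and normalized so that
countably many such functions can be summed with geometric weights. -/
theorem BoundedVariationOn.exists_continuous_monotone {E : Type*} [PseudoMetricSpace E] {f : ℝ → E}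
    (hf : Continuous f) (hv : BoundedVariationOn f univ) :
    ∃ L : ℝ → ℝ, Continuous L ∧ Monotone L ∧ (∀ t, ‖L t‖ ≤ 1) ∧
      ∃ c : ℝ≥0, ∀ s t, dist (f s) (f t) ≤ c * |L s - L t| := by
  have hfin : ∀ s : Set ℝ, eVariationOn f s ≠ ⊤ := fun s => hv.mono (subset_univ s)
  have hadd : ∀ s t, s ≤ t → (eVariationOn f (Iic t)).toReal =
      (eVariationOn f (Iic s)).toReal + (eVariationOn f (Icc s t)).toReal := fun s t hst => by
    rw [← ENNReal.toReal_add (hfin _) (hfin _), ← eVariationOn.union f isGreatest_Iic (isLeast_Icc hst),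
      Iic_union_Icc_eq_Iic hst]
  set N : ℝ → ℝ := fun t => (eVariationOn f (Iic t)).toReal with hN
  have hmono : Monotone N := fun s t hst => by
    simp only [hN]; rw [hadd s t hst]; linarith [ENNReal.toReal_nonneg (a := eVariationOn f (Icc s t))]
  have hcont : Continuous N := by
    refine continuous_iff_continuousAt.2 fun x => ?_
    have hR : ContinuousWithinAt N (Ici x) x := by
      have h1 := hv.tendsto_eVariationOn_Ioc_zero x
      rw [nhdsWithin_univ] at h1
      have h2 := ((ENNReal.tendsto_toReal ENNReal.zero_ne_top).comp
        (h1.mono_left (nhdsWithin_le_nhds (s := Ici x)))).const_add (N x)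
      rw [ENNReal.toReal_zero, add_zero] at h2
      refine h2.congr' ?_
      filter_upwards [self_mem_nhdsWithin] with y hy
      rw [Function.comp_apply, univ_inter,
        eVariationOn.eVariationOn_Ioc_eq_Icc_of_continuousWithinAt hf.continuousWithinAt]
      exact (hadd x y hy).symm
    have hL : ContinuousWithinAt N (Iic x) x := by
      have h1 := hv.tendsto_eVariationOn_Ico_zero x
      rw [nhdsWithin_univ] at h1
      have h2 := ((ENNReal.tendsto_toReal ENNReal.zero_ne_top).comp
        (h1.mono_left (nhdsWithin_le_nhds (s := Iic x)))).const_sub (N x)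
      rw [ENNReal.toReal_zero, sub_zero] at h2
      refine h2.congr' ?_
      filter_upwards [self_mem_nhdsWithin] with y hy
      rw [Function.comp_apply, univ_inter,
        eVariationOn.eVariationOn_Ico_eq_Icc_of_continuousWithinAt hf.continuousWithinAt]
      have := hadd y x hy
      simp only [hN]
      linarith
    exact continuousAt_iff_continuous_left_right.2 ⟨hL, hR⟩
  set T : ℝ≥0 := (eVariationOn f univ).toNNReal + 1 with hT
  have hT0 : (0 : ℝ) < T := by positivity
  have hNT : ∀ t, N t ≤ T := fun t => by
    rw [hT, NNReal.coe_add]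
    have : N t ≤ (eVariationOn f univ).toReal :=
      ENNReal.toReal_mono (hfin _) (eVariationOn.mono f (subset_univ _))
    have h2 : (eVariationOn f univ).toReal = ((eVariationOn f univ).toNNReal : ℝ) := rfl
    push_cast
    linarith
  refine ⟨fun t => N t / T, by fun_prop, fun s t hst => ?_, fun t => ?_, T, fun s t => ?_⟩
  · exact div_le_div_of_nonneg_right (hmono hst) hT0.le
  · rw [Real.norm_of_nonneg (by positivity), div_le_one hT0]
    exact hNT t
  · rw [← sub_div, abs_div, abs_of_pos hT0, mul_div_cancel₀ _ hT0.ne']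
    wlog hst : s ≤ t generalizing s t
    · rw [dist_comm, abs_sub_comm]
      exact this t s (not_le.1 hst).le
    have h1 := hadd s t hst
    have h2 : dist (f s) (f t) ≤ (eVariationOn f (Icc s t)).toReal :=
      BoundedVariationOn.dist_le (hfin _) (left_mem_Icc.2 hst) (right_mem_Icc.2 hst)
    rw [abs_sub_comm]
    exact h2.trans ((by simp only [hN]; linarith : _ ≤ N t - N s).trans (le_abs_self _))

variable {n : ℕ} {M : Type*} [TopologicalSpace M] [ChartedSpace (EuclideanSpace ℝ (Fin n)) M]

/-- Rectifiable curves have locally Lipschitz parametrizations. -/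
theorem IsRectifiable.exists_isLocallyLipschitz_comp [IsManifold (𝓡 n) ∞ M] {f : ℝ → M}
    (hf : IsRectifiable n f) : ∃ h : ℝ ≃o ℝ, IsLocallyLipschitz n (f ∘ h) := by
  have hloc : ∀ t, ∃ U ∈ 𝓝 t, (∀ s ∈ U, f s ∈ (extChartAt (𝓡 n) (f t)).source) ∧
      ∃ L : ℝ → ℝ, Continuous L ∧ Monotone L ∧ (∀ s, ‖L s‖ ≤ 1) ∧ ∃ c : ℝ≥0, ∀ s ∈ U, ∀ r ∈ U,
        dist (extChartAt (𝓡 n) (f t) (f s)) (extChartAt (𝓡 n) (f t) (f r)) ≤ c * |L s - L r| := by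
    intro t
    obtain ⟨s, hs, hv⟩ := hf.2 t
    have h1 : f ⁻¹' (extChartAt (𝓡 n) (f t)).source ∈ 𝓝 t :=
      hf.1.continuousAt (extChartAt_source_mem_nhds (f t))
    obtain ⟨ε, hε, hsub⟩ := Metric.nhds_basis_closedBall.mem_iff.1 (inter_mem hs h1)
    rw [Real.closedBall_eq_Icc] at hsub
    have hle : t - ε ≤ t + ε := by linarith
    have hmem : ∀ r, (projIcc (t - ε) (t + ε) hle r : ℝ) ∈ Icc (t - ε) (t + ε) := fun r =>
      (projIcc (t - ε) (t + ε) hle r).2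
    -- Freezing the curve outside the interval gives a function of bounded variation on the whole
    -- line.
    obtain ⟨L, hL1, hL2, hL3, c, hc⟩ := BoundedVariationOn.exists_continuous_monotone
      (f := (extChartAt (𝓡 n) (f t) ∘ f) ∘ fun r => (projIcc (t - ε) (t + ε) hle r : ℝ)) (by
        refine ContinuousOn.comp_continuous (s := Icc (t - ε) (t + ε)) ?_
          (continuous_subtype_val.comp continuous_projIcc) hmem
        exact (continuousOn_extChartAt (f t)).comp hf.1.continuousOn fun r hr => (hsub hr).2) (by
        refine ne_top_of_le_ne_top hv (eVariationOn.comp_le_of_monotoneOn _ _ ?_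
          fun r _ => (hsub (hmem r)).1)
        exact fun a _ b _ hab => (monotone_projIcc hle) hab)
    refine ⟨Icc (t - ε) (t + ε), ?_, fun r hr => (hsub hr).2, L, hL1, hL2, hL3, c,
      fun a ha b hb => ?_⟩
    · rw [← Real.closedBall_eq_Icc]
      exact Metric.closedBall_mem_nhds t hε
    · have := hc a b
      simpa only [Function.comp_apply, projIcc_of_mem hle ha, projIcc_of_mem hle hb] using this
  choose U hU hsrc L hLc hLm hLb c hc using hloc
  obtain ⟨S, hSc, hS⟩ := TopologicalSpace.countable_cover_nhds fun t => interior_mem_nhds.2 (hU t)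
  have hSne : S.Nonempty := by
    by_contra hne
    rw [not_nonempty_iff_eq_empty] at hne
    simp [hne] at hS
    exact (Set.empty_ne_univ (α := ℝ)) (by simpa using hS)
  obtain ⟨u, rfl⟩ := hSc.exists_eq_range hSne
  have hsum : ∀ t, Summable fun i => (1 / 2 : ℝ) ^ i * L (u i) t := fun t =>
    summable_geometric_two.of_norm_bounded fun i => by
      rw [norm_mul, Real.norm_of_nonneg (by positivity)]
      exact mul_le_of_le_one_right (by positivity) (hLb _ _)
  -- Each local variation function is dominated by `Λ` up to the factor `2 ^ i`, so the parameter `t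
  -- + Λ t` serves all the charts of the countable cover at once.
  let Λ : ℝ → ℝ := fun t => ∑' i, (1 / 2 : ℝ) ^ i * L (u i) t
  have hΛm : Monotone Λ := fun s t hst =>
    (hsum s).tsum_le_tsum (fun i => by gcongr; exact hLm _ hst) (hsum t)
  have hΛc : Continuous Λ := continuous_tsum (fun i => continuous_const.mul (hLc (u i)))
    summable_geometric_two fun i t => by
      rw [norm_mul, Real.norm_of_nonneg (by positivity)]
      exact mul_le_of_le_one_right (by positivity) (hLb _ _)
  have hΛ : ∀ i s t, (1 / 2 : ℝ) ^ i * |L (u i) s - L (u i) t| ≤ |Λ s - Λ t| := by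
    intro i s t
    wlog hst : s ≤ t generalizing s t
    · rw [abs_sub_comm, abs_sub_comm (Λ s)]
      exact this t s (not_le.1 hst).le
    rw [abs_of_nonpos (sub_nonpos.2 (hLm _ hst)), abs_of_nonpos (sub_nonpos.2 (hΛm hst)), neg_sub,
      neg_sub]
    have h1 : Λ t - Λ s = ∑' i, ((1 / 2 : ℝ) ^ i * L (u i) t - (1 / 2 : ℝ) ^ i * L (u i) s) :=
      ((hsum t).tsum_sub (hsum s)).symm
    rw [h1, mul_sub]
    exact ((hsum t).sub (hsum s)).le_tsum i fun j _ =>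
      sub_nonneg.2 (by gcongr; exact hLm _ hst)
  obtain ⟨h, -, hh1, hh2⟩ := exists_orderIso_add hΛc hΛm
  refine ⟨h, isLocallyLipschitz_iff.2 fun τ => ?_⟩
  have hτ : h τ ∈ ⋃ x ∈ range u, interior (U x) := hS ▸ mem_univ _
  simp only [mem_range, iUnion_exists, iUnion_iUnion_eq', mem_iUnion] at hτ
  obtain ⟨i, hi⟩ := hτ
  have hfh : Continuous (f ∘ h) := hf.1.comp h.continuous
  refine LipschitzNear.of_chart (p := f (u i)) hfh.continuousAt ?_
    ⟨c (u i) * 2 ^ i, h ⁻¹' interior (U (u i)),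
      h.continuous.continuousAt (isOpen_interior.mem_nhds hi),
      LipschitzOnWith.of_dist_le_mul fun a ha b hb => ?_⟩
  · have := hsrc (u i) (h τ) (interior_subset hi)
    rwa [extChartAt_source] at this
  · refine (hc (u i) (h a) (interior_subset ha) (h b) (interior_subset hb)).trans ?_
    have h1 := hΛ i (h a) (h b)
    have h2 : |Λ (h a) - Λ (h b)| ≤ dist a b := by
      simpa [Real.dist_eq] using hh2.dist_le_mul a b
    have h3 : |L (u i) (h a) - L (u i) (h b)| ≤ 2 ^ i * dist a b := by
      have := h1.trans h2
      rwa [one_div, inv_pow, inv_mul_le_iff₀ (by positivity)] at this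
    push_cast
    rw [mul_assoc]
    gcongr

theorem IsLocallyLipschitz.isRectifiable_comp {g : ℝ → M} (hg : IsLocallyLipschitz n g) (h : ℝ ≃o ℝ) :
    IsRectifiable n (g ∘ h) := by
  refine ⟨hg.1.comp h.continuous, fun t => ?_⟩
  obtain ⟨K, s, hs, hK⟩ := hg.2 (h t)
  obtain ⟨ε, hε, hsub⟩ := Metric.nhds_basis_closedBall.mem_iff.1 hs
  have hball := Metric.closedBall_mem_nhds (h t) hε
  rw [Real.closedBall_eq_Icc] at hsub hball
  refine ⟨h ⁻¹' Icc (h t - ε) (h t + ε), h.continuous.continuousAt hball, ?_⟩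
  have hbv : BoundedVariationOn (extChartAt (𝓡 n) (g (h t)) ∘ g) (Icc (h t - ε) (h t + ε)) := by
    have := (hK.mono hsub).locallyBoundedVariationOn (h t - ε) (h t + ε)
      (left_mem_Icc.2 (by linarith)) (right_mem_Icc.2 (by linarith))
    rwa [inter_self] at this
  exact ne_top_of_le_ne_top hbv (eVariationOn.comp_le_of_monotoneOn _ h (h.monotone.monotoneOn _)
    (mapsTo_preimage h _))

end Reparametrization

/-! ### Completeness implies development -/

section Complete

variable {n k : ℕ} {M : Type*} [TopologicalSpace M] [ChartedSpace (EuclideanSpace ℝ (Fin n)) M]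
  [IsManifold (𝓡 n) ∞ M] {V : Type*} [NormedAddCommGroup V] [NormedSpace ℝ V]
  [FiniteDimensional ℝ V]
  {M₀ : Type*} [TopologicalSpace M₀] [ChartedSpace (EuclideanSpace ℝ (Fin k)) M₀]
  [IsManifold (𝓡 k) ∞ M₀] {V₀ : Type*} [NormedAddCommGroup V₀] [NormedSpace ℝ V₀]
  [FiniteDimensional ℝ V₀]

/-- Curves develop to a manifold with a complete canonical metric. -/
theorem Coframing.curvesDevelop_of_isCompleteMetric [T2Space M] (θ₀ : Coframing k M₀ V₀)
    (θ : Coframing n M V) (A : V₀ →ₗ[ℝ] V) {B : V →L[ℝ] V →L[ℝ] ℝ} (hB : IsInnerProduct B)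
    (hcomp : IsCompleteMetric (θ.canonicalMetric B hB)) : CurvesDevelop θ₀ θ A := by
  intro f₀ hf₀ t₀ m₁
  obtain ⟨h, hh⟩ := hf₀.exists_isLocallyLipschitz_comp
  have hint := θ₀.locallyIntegrable_form_velocity hh
  let A' : V₀ →L[ℝ] V := LinearMap.toContinuousLinearMap A
  -- The equation is solved in the Lipschitz parameter, starting at `h.symm t₀`, and `h` is undone
  -- afterwards.
  obtain ⟨g, hg0, hg⟩ := exists_hasVelocityOn_univ hB hcomp
    (w := fun s => A' (θ₀.form ((f₀ ∘ h) s) (velocity k (f₀ ∘ h) s)))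
    (A'.continuous.comp_aestronglyMeasurable hint.aestronglyMeasurable) (by
      intro T
      obtain ⟨D⟩ := θ₀.nonempty_chartData ((f₀ ∘ h) T)
      obtain ⟨ε, hε, K, C, -, -, hD⟩ := D.exists_ball isOpen_univ
        (fun t _ => isLocallyLipschitz_iff.1 hh t) (mem_univ T) rfl
      refine ⟨‖A'‖₊ * C, ε, hε, Eventually.of_forall fun s hs => ?_⟩
      exact A'.le_opNorm_of_le (hD s hs).2.2.2) (h.symm t₀) m₁
  have hgl : IsLocallyLipschitz n g := isLocallyLipschitz_iff.2 fun t => hg.1 t (mem_univ t)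
  have hcomp' : (g ∘ h.symm) ∘ h = g := by ext; simp
  refine ⟨g ∘ h.symm, IsLocallyLipschitz.isRectifiable_comp hgl h.symm, hg0, h, hh, ?_, ?_⟩
  · rwa [hcomp']
  · filter_upwards [hg.2] with s hs
    change θ.form (((g ∘ h.symm) ∘ h) s) (velocity n ((g ∘ h.symm) ∘ h) s) = _
    rw [hcomp']
    exact hs (mem_univ s)

end Complete

/-! ### Joining nearby points at bounded speed -/

section Paths

variable {n : ℕ} {M : Type*} [TopologicalSpace M] [ChartedSpace (EuclideanSpace ℝ (Fin n)) M]

theorem LipschitzNear.ite {g g' : ℝ → M} {t : ℝ} (hg : LipschitzNear n g t)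
    (hg' : LipschitzNear n g' t) (heq : g t = g' t) :
    LipschitzNear n (fun s => if s < t then g s else g' s) t := by
  obtain ⟨hc, K, s, hs, hK⟩ := hg
  obtain ⟨hc', K', s', hs', hK'⟩ := hg'
  rw [← heq] at hK'
  have ht : (fun s => if s < t then g s else g' s) t = g t := by simp [heq]
  refine ⟨?_, max K K', s ∩ s', inter_mem hs hs', ?_⟩
  · have h1 : Tendsto g' (𝓝 t) (𝓝 (g t)) := heq ▸ hc'
    unfold ContinuousAt
    simp only [lt_self_iff_false, if_false, ← heq]
    exact Tendsto.if' hc h1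
  · rw [ht]
    have key : ∀ a ∈ s ∩ s', ∀ b ∈ s ∩ s', a ≤ b →
        dist ((extChartAt (𝓡 n) (g t) ∘ fun s => if s < t then g s else g' s) a)
          ((extChartAt (𝓡 n) (g t) ∘ fun s => if s < t then g s else g' s) b) ≤
        max K K' * dist a b := by
      intro a ha b hb hab
      have h1 : ∀ r : ℝ, 0 ≤ r → K * r ≤ max K K' * r := fun r hr => by
        gcongr; exact_mod_cast le_max_left K K'
      have h2 : ∀ r : ℝ, 0 ≤ r → K' * r ≤ max K K' * r := fun r hr => by
        gcongr; exact_mod_cast le_max_right K K'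
      simp only [Function.comp_apply]
      by_cases hat : a < t
      · by_cases hbt : b < t
        · rw [if_pos hat, if_pos hbt]
          exact (hK.dist_le_mul a ha.1 b hb.1).trans (h1 _ dist_nonneg)
        · rw [if_pos hat, if_neg hbt]
          have h3 := hK.dist_le_mul a ha.1 t (mem_of_mem_nhds hs)
          have h4 := hK'.dist_le_mul t (mem_of_mem_nhds hs') b hb.2
          simp only [Function.comp_apply, ← heq] at h3 h4
          have h5 : dist a t + dist t b = dist a b := by
            simp only [Real.dist_eq]
            rw [abs_of_neg (by linarith), abs_of_nonpos (by linarith), abs_of_nonpos (by linarith)]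
            ring
          have h6 := dist_triangle (extChartAt (𝓡 n) (g t) (g a)) (extChartAt (𝓡 n) (g t) (g t))
            (extChartAt (𝓡 n) (g t) (g' b))
          have h7 := h1 _ (dist_nonneg (x := a) (y := t))
          have h8 := h2 _ (dist_nonneg (x := t) (y := b))
          rw [← h5, mul_add]
          linarith
      · rw [if_neg hat, if_neg (fun h => hat (hab.trans_lt h))]
        exact (hK'.dist_le_mul a ha.2 b hb.2).trans (h2 _ dist_nonneg)
    refine LipschitzOnWith.of_dist_le_mul fun a ha b hb => ?_
    rcases le_total a b with hab | hab
    · exact_mod_cast key a ha b hb hab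
    · rw [dist_comm, dist_comm a]
      exact_mod_cast key b hb a ha hab

variable [IsManifold (𝓡 n) ∞ M] {V : Type*} [NormedAddCommGroup V] [NormedSpace ℝ V]

theorem ContMDiff.isLocallyLipschitz {γ : ℝ → M} (hγ : ContMDiff 𝓘(ℝ, ℝ) (𝓡 n) 1 γ) :
    IsLocallyLipschitz n γ := by
  have : IsManifold (𝓡 n) 1 M := IsManifold.of_le (n := ∞) (by norm_cast)
  refine ⟨hγ.continuous, fun t => ?_⟩
  have h : ContMDiffAt 𝓘(ℝ, ℝ) 𝓘(ℝ, EuclideanSpace ℝ (Fin n)) 1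
      (extChartAt (𝓡 n) (γ t) ∘ γ) t :=
    (contMDiffAt_extChartAt' (mem_chart_source _ _)).comp t (hγ t)
  exact (contMDiffAt_iff_contDiffAt.1 h).exists_lipschitzOnWith

namespace Coframing

/-- Here `g'` has the right velocity only between `a` and `b`. Following `g` up to `a` and `g'`
afterwards gives a curve to which uniqueness applies on `I ∩ Iio b`; the endpoint `b` follows by
continuity. -/
theorem HasVelocityOn.eqOn_Icc [FiniteDimensional ℝ V] [T2Space M] {θ : Coframing n M V}
    {w : ℝ → V} {I : Set ℝ} {g g' : ℝ → M}
    (h : θ.HasVelocityOn w I g) (hI : IsOpen I) (hord : I.OrdConnected) {a b : ℝ} (hab : a < b)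
    (ha : a ∈ I) (hb : b ∈ I) (hg' : ∀ t ∈ I, LipschitzNear n g' t)
    (hw : ∀ᵐ s, s ∈ Ioo a b → θ.form (g' s) (velocity n g' s) = w s) (heq : g a = g' a) :
    EqOn g g' (Icc a b) := by
  set f : ℝ → M := fun s => if s < a then g s else g' s with hf
  have hleft : ∀ t, t < a → f =ᶠ[𝓝 t] g := fun t ht => by
    filter_upwards [eventually_lt_nhds ht] with s hs
    exact if_pos hs
  have hright : ∀ t, a < t → f =ᶠ[𝓝 t] g' := fun t ht => by
    filter_upwards [eventually_gt_nhds ht] with s hs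
    exact if_neg (not_lt.2 (le_of_lt hs))
  have hlip : ∀ t ∈ I, LipschitzNear n f t := fun t ht => by
    rcases lt_trichotomy t a with hta | rfl | hta
    · exact (h.1 t ht).congr (hleft t hta)
    · exact (h.1 t ht).ite (hg' t ht) heq
    · exact (hg' t ht).congr (hright t hta)
  have hfv : θ.HasVelocityOn w (I ∩ Iio b) f := by
    refine ⟨fun t ht => hlip t ht.1, ?_⟩
    filter_upwards [h.2, hw, Measure.ae_ne volume a] with s h1 h2 hne hs
    rcases lt_or_gt_of_ne hne with hsa | hsa
    · rw [θ.form_velocity_congr (hleft s hsa) (hlip s hs.1).1]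
      exact h1 hs.1
    · rw [θ.form_velocity_congr (hright s hsa) (hlip s hs.1).1]
      exact h2 ⟨hsa, hs.2⟩
  have hfa : f a = g a := by simp [hf, heq]
  have h1 := (h.mono inter_subset_left).eqOn hfv (hI.inter isOpen_Iio)
    (hord.inter ordConnected_Iio).isPreconnected (t₀ := a) ⟨ha, hab⟩ hfa.symm
  have hIcc : Icc a b ⊆ I := hord.out ha hb
  have h2 : EqOn g g' (Ico a b) := fun s hs => by
    rw [h1 ⟨hIcc ⟨hs.1, hs.2.le⟩, hs.2⟩]
    exact if_neg (not_lt.2 hs.1)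
  refine h2.of_subset_closure (h.continuousOn.mono hIcc)
    (fun t ht => (hg' t (hIcc ht)).1.continuousWithinAt) Ico_subset_Icc_self ?_
  rw [closure_Ico hab.ne]

/-- Nearby points are joined by curves in short time with velocity bounded by a constant. -/
theorem exists_hasVelocityOn_of_edist_lt [FiniteDimensional ℝ V] (θ : Coframing n M V)
    {B : V →L[ℝ] V →L[ℝ] ℝ} (hB : IsInnerProduct B) {C : ℝ≥0} (hC : ∀ v, ‖v‖ ≤ C * √(B v v))
    {x y : M} {r : ℝ} (hr : 0 < r) (h : θ.edist hB x y < ENNReal.ofReal r) :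
    ∃ τ ∈ Ioo 0 (2 * r), ∃ (g : ℝ → M) (w : ℝ → V), g 0 = x ∧ g τ = y ∧
      θ.HasVelocityOn w univ g ∧ AEStronglyMeasurable w ∧ ∀ᵐ s, ‖w s‖ ≤ C := by
  obtain ⟨γ, hγ0, hγr, hγ, hlen⟩ := θ.exists_path_of_edist_lt hB h hr
  have hγl := hγ.isLocallyLipschitz
  have hint := θ.locallyIntegrable_form_velocity hγl
  set v : ℝ → V := fun t => θ.form (γ t) (velocity n γ t) with hv
  set σ : ℝ → ℝ := fun t => √(B (v t) (v t)) with hσ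
  have hσ0 : ∀ t, 0 ≤ σ t := fun t => Real.sqrt_nonneg _
  obtain ⟨c, hc⟩ := IsInnerProduct.exists_sqrt_le B
  have hBc : Continuous fun u : V => √(B u u) :=
    (B.continuous.clm_apply continuous_id).sqrt
  have hσi : LocallyIntegrable σ := by
    intro t
    obtain ⟨s, hs, hi⟩ := hint t
    refine ⟨s, hs, Integrable.mono' (hi.norm.const_mul (c : ℝ)) (hBc.comp_aestronglyMeasurable hi.1)
      (Eventually.of_forall fun r => ?_)⟩
    rw [Real.norm_of_nonneg (hσ0 r)]
    exact hc (v r)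
  have hσii : ∀ a b, IntervalIntegrable σ volume a b := fun a b =>
    intervalIntegrable_iff.2 ((hσi.integrableOn_isCompact isCompact_uIcc).mono_set uIoc_subset_uIcc)
  set L : ℝ → ℝ := fun t => ∫ s in (0 : ℝ)..t, σ s with hL
  have hLc : Continuous L := intervalIntegral.continuous_primitive hσii 0
  have hLsub : ∀ s t, L t - L s = ∫ r in s..t, σ r := fun s t =>
    intervalIntegral.integral_interval_sub_left (hσii _ _) (hσii _ _)
  have hLm : Monotone L := fun s t hst => by
    have := hLsub s t
    have h2 : 0 ≤ ∫ r in s..t, σ r := intervalIntegral.integral_nonneg hst fun r _ => hσ0 r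
    linarith
  have hL0 : L 0 = 0 := intervalIntegral.integral_same
  have hLr : L r < r := by
    have h1 : L r = ∫ s in Ioo 0 r, σ s := by
      rw [hL, ← integral_Ioc_eq_integral_Ioo]
      exact intervalIntegral.integral_of_le hr.le
    rw [h1, integral_eq_lintegral_of_nonneg_ae (Eventually.of_forall hσ0)
      hσi.aestronglyMeasurable.restrict]
    exact (ENNReal.lt_ofReal_iff_toReal_lt (hlen.ne_top)).1 hlen
  -- The new parameter is `t + L t`, not the arc length `L`, since `γ` may stop. The new speed is `σ
  -- / (1 + σ) ≤ 1`, and the duration is `r + L r < 2 * r`.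
  obtain ⟨k, hk, hk1, -⟩ := exists_orderIso_add hLc hLm
  have hk' : ∀ t, k.symm t = t + L t := fun t => by
    have := hk (k.symm t)
    rwa [k.apply_symm_apply, eq_comm] at this
  have hk0 : k 0 = 0 := by
    have := hk' 0
    rw [hL0, add_zero, k.symm_apply_eq] at this
    exact this.symm
  have hLr0 : 0 ≤ L r := hL0 ▸ hLm hr.le
  have hγv : θ.HasVelocityOn v univ γ :=
    ⟨fun t _ => isLocallyLipschitz_iff.1 hγl t, Eventually.of_forall fun _ _ => rfl⟩
  have hgv := hγv.comp isOpen_univ hk1 k.injective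
  rw [preimage_univ] at hgv
  have hgl : IsLocallyLipschitz n (γ ∘ k) := isLocallyLipschitz_iff.2 fun t => hgv.1 t (mem_univ t)
  refine ⟨k.symm r, ⟨by rw [hk']; linarith, by rw [hk']; linarith⟩, γ ∘ k, _, ?_, ?_,
    ⟨hgv.1, Eventually.of_forall fun _ _ => rfl⟩,
    (θ.locallyIntegrable_form_velocity hgl).aestronglyMeasurable, ?_⟩
  · rw [Function.comp_apply, hk0, hγ0]
  · rw [Function.comp_apply, k.apply_symm_apply, hγr]
  · filter_upwards [hgv.2, hk1.ae_differentiableAt_real, ae_hasDerivAt_zero_of_injective hk1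
      k.injective (_root_.LocallyIntegrable.ae_hasDerivAt_integral hσi)] with s h1 h2 h3
    rw [h1 (mem_univ s), norm_smul]
    -- Either `L` has derivative `σ` at `k s`, or `k` has derivative `0` at `s` and the velocity
    -- vanishes.
    rcases h3 with h3 | h3
    · have h4 : HasDerivAt (fun τ => k τ + L (k τ)) (deriv k s + σ (k s) * deriv k s) s :=
        h2.hasDerivAt.add ((h3 0).comp s h2.hasDerivAt)
      have h5 : deriv k s * (1 + σ (k s)) = 1 := by
        have h6 : HasDerivAt (fun τ => k τ + L (k τ)) 1 s := by
          simp only [hk]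
          exact hasDerivAt_id s
        have := h4.unique h6
        linarith
      have h6 : ‖deriv k s‖ * (1 + σ (k s)) = 1 := by
        have := congrArg norm h5
        rwa [norm_mul, Real.norm_of_nonneg (by linarith [hσ0 (k s)] : 0 ≤ 1 + σ (k s)), norm_one]
          at this
      calc ‖deriv k s‖ * ‖v (k s)‖ ≤ ‖deriv k s‖ * (C * σ (k s)) := by gcongr; exact hC _
        _ = C * (‖deriv k s‖ * σ (k s)) := by ring
        _ ≤ C * 1 := by gcongr; linarith [norm_nonneg (deriv k s)]
        _ = C := mul_one _
    · rw [h3.deriv, norm_zero, zero_mul]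
      exact C.2

end Coframing

end Paths

/-! ### Development implies completeness -/

section Converse

variable {n k : ℕ} {M : Type*} [TopologicalSpace M] [ChartedSpace (EuclideanSpace ℝ (Fin n)) M]
  [IsManifold (𝓡 n) ∞ M] {V : Type*} [NormedAddCommGroup V] [NormedSpace ℝ V]
  [FiniteDimensional ℝ V]
  {M₀ : Type*} [TopologicalSpace M₀] [ChartedSpace (EuclideanSpace ℝ (Fin k)) M₀]
  [IsManifold (𝓡 k) ∞ M₀] {V₀ : Type*} [NormedAddCommGroup V₀] [NormedSpace ℝ V₀]
  [FiniteDimensional ℝ V₀]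

/-- A development satisfies the equation between velocities in any parametrization
`h` in which `f₀` is Lipschitz, up to a further change of parameter. -/
theorem IsDevelopment.exists_hasVelocityOn {θ₀ : Coframing k M₀ V₀} {θ : Coframing n M V}
    {A : V₀ →ₗ[ℝ] V} {f₀ : ℝ → M₀} {f₁ : ℝ → M} (hdev : IsDevelopment θ₀ θ A f₀ f₁)
    {w : ℝ → V₀} {J : Set ℝ} (hJ : IsOpen J) (hf₀ : θ₀.HasVelocityOn w J f₀) :
    ∃ h : ℝ ≃o ℝ, LipschitzWith 1 h ∧
      θ.HasVelocityOn (fun s => deriv h s • A (w (h s))) (h ⁻¹' J) (f₁ ∘ h) := by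
  obtain ⟨h, hl₀, hl₁, hae⟩ := hdev
  -- The change of parameter `h` in a development need not be Lipschitz. Composing with the inverse
  -- `u` of `t + h t` makes both `u` and `h ∘ u` Lipschitz, and the velocity of `f₀ ∘ h ∘ u` can be
  -- computed in two ways.
  obtain ⟨u, -, hu1, hu2⟩ := exists_orderIso_add h.continuous h.monotone
  set v : ℝ → V₀ := fun s => θ₀.form ((f₀ ∘ h) s) (velocity k (f₀ ∘ h) s) with hv
  have h0 : θ₀.HasVelocityOn v univ (f₀ ∘ h) :=
    ⟨fun t _ => isLocallyLipschitz_iff.1 hl₀ t, Eventually.of_forall fun _ _ => rfl⟩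
  have h1 : θ.HasVelocityOn (fun s => A (v s)) univ (f₁ ∘ h) :=
    ⟨fun t _ => isLocallyLipschitz_iff.1 hl₁ t, hae.mono fun s hs _ => hs⟩
  have h0u := h0.comp isOpen_univ hu1 u.injective
  have h1u := h1.comp isOpen_univ hu1 u.injective
  have h0k := hf₀.comp hJ hu2 (h.injective.comp u.injective)
  refine ⟨u.trans h, hu2, (h1u.mono (subset_univ _)).congr_ae ?_⟩
  filter_upwards [h0u.2, h0k.2] with s e0 e1 hs
  have e2 := (e0 (mem_univ _)).symm.trans (e1 hs)
  rw [← map_smul, e2, map_smul]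
  rfl

theorem exists_concatenation {V : Type*} [NormedAddCommGroup V] {T : ℕ → ℝ} (hT : StrictMono T)
    {C : ℝ≥0} {W : ℕ → ℝ → V} (hm : ∀ i, AEStronglyMeasurable (W i))
    (hC : ∀ i, ∀ᵐ s, ‖W i s‖ ≤ C) :
    ∃ w : ℝ → V, AEStronglyMeasurable w ∧ (∀ᵐ s, ‖w s‖ ≤ C) ∧
      ∀ i, ∀ s ∈ Ico (T i) (T (i + 1)), w s = W i s := by
  classical
  let w : ℝ → V := fun s => if h : ∃ i, s ∈ Ico (T i) (T (i + 1)) then W h.choose s else 0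
  have hw : ∀ i, ∀ s ∈ Ico (T i) (T (i + 1)), w s = W i s := fun i s hs => by
    have h : ∃ i, s ∈ Ico (T i) (T (i + 1)) := ⟨i, hs⟩
    have : h.choose = i := by
      by_contra hne
      exact disjoint_left.1 (hT.monotone.pairwise_disjoint_on_Ico_succ hne) h.choose_spec hs
    simp only [w, dif_pos h, this]
  refine ⟨w, ?_, ?_, hw⟩
  · have hind : w = (⋃ i, Ico (T i) (T (i + 1))).indicator w := by
      ext s
      by_cases h : ∃ i, s ∈ Ico (T i) (T (i + 1))
      · rw [indicator_of_mem (mem_iUnion.2 h)]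
      · rw [indicator_of_notMem (fun hs => h (mem_iUnion.1 hs))]
        simp only [w, dif_neg h]
    rw [hind, aestronglyMeasurable_indicator_iff (MeasurableSet.iUnion fun i => measurableSet_Ico),
      aestronglyMeasurable_iUnion_iff]
    intro i
    refine (hm i).restrict.congr ?_
    filter_upwards [ae_restrict_mem measurableSet_Ico] with s hs using (hw i s hs).symm
  · filter_upwards [ae_all_iff.2 hC] with s hs
    by_cases h : ∃ i, s ∈ Ico (T i) (T (i + 1))
    · obtain ⟨i, hi⟩ := h
      rw [hw i s hi]
      exact hs i
    · simp only [w, dif_neg h, norm_zero]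
      exact C.2

/-- If curves develop from some manifold then every canonical metric is complete. -/
theorem CurvesDevelop.isCompleteMetric [T2Space M] [Nonempty M₀] {θ₀ : Coframing k M₀ V₀}
    {θ : Coframing n M V} (A : V₀ ≃ₗ[ℝ] V) (hdev : CurvesDevelop θ₀ θ (A : V₀ →ₗ[ℝ] V))
    {B : V →L[ℝ] V →L[ℝ] ℝ} (hB : IsInnerProduct B) :
    IsCompleteMetric (θ.canonicalMetric B hB) := by
  obtain ⟨p⟩ := ‹Nonempty M₀›
  obtain ⟨C, hC0, hC⟩ := hB.exists_le_sqrt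
  let A' : V →L[ℝ] V₀ := LinearMap.toContinuousLinearMap (A.symm : V →ₗ[ℝ] V₀)
  have hAA' : ∀ v, A (A' v) = v := fun v => A.apply_symm_apply v
  -- The lifetime `δ` in `M₀` is fixed before the sequence is given; the subsequence is then chosen
  -- so that it is traversed within time `δ / 2`.
  obtain ⟨δ, hδ, U, hU, hex⟩ := θ₀.exists_hasVelocityOn_ball p (‖A'‖₊ * C)
  rw [θ.isCompleteMetric_iff hB]
  intro z hz
  -- a subsequence `x` whose successive distances have a small sum
  have hε : ∀ i : ℕ, 0 < δ / 8 * (1 / 2 : ℝ) ^ i := fun i => by positivity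
  choose N hN using fun i => hz (ENNReal.ofReal (δ / 8 * (1 / 2) ^ i))
    (ENNReal.ofReal_pos.2 (hε i))
  -- Partial suprema make the indices monotone.
  let φ : ℕ → ℕ := fun i => partialSups N i
  have hφm : Monotone φ := (partialSups N).monotone
  have hφN : ∀ i, N i ≤ φ i := fun i => le_partialSups N i
  set x : ℕ → M := fun i => z (φ i) with hx
  have hxd : ∀ i, θ.edist hB (x i) (x (i + 1)) < ENNReal.ofReal (δ / 8 * (1 / 2) ^ i) := fun i =>
    hN i _ (hφN i) _ ((hφN i).trans (hφm i.le_succ))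
  choose τ hτ G W hG0 hGτ hGv hWm hWC using fun i =>
    θ.exists_hasVelocityOn_of_edist_lt hB hC (hε i) (hxd i)
  let T : ℕ → ℝ := fun i => ∑ j ∈ Finset.range i, τ j
  have hT0 : T 0 = 0 := Finset.sum_range_zero _
  have hTs : ∀ i, T (i + 1) = T i + τ i := fun i => Finset.sum_range_succ _ _
  have hT : StrictMono T := strictMono_nat_of_lt_succ fun i => by rw [hTs]; linarith [(hτ i).1]
  have hsum : Summable τ := by
    refine Summable.of_nonneg_of_le (fun i => (hτ i).1.le) (fun i => (hτ i).2.le) ?_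
    exact (summable_geometric_two.mul_left (δ / 8)).mul_left 2
  set S := ∑' i, τ i with hS
  have hTS : Tendsto T atTop (𝓝 S) := hsum.hasSum.tendsto_sum_nat
  have hTlt : ∀ i, T i < S := fun i =>
    (hT i.lt_succ_self).trans_le (hsum.sum_le_tsum _ fun j _ => (hτ j).1.le)
  have hSδ : S ≤ δ / 2 := by
    have h1 : S ≤ ∑' i : ℕ, 2 * (δ / 8 * (1 / 2 : ℝ) ^ i) :=
      hsum.tsum_le_tsum (fun i => (hτ i).2.le)
        ((summable_geometric_two.mul_left (δ / 8)).mul_left 2)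
    rw [tsum_mul_left, tsum_mul_left, tsum_geometric_two] at h1
    linarith
  have hshift : ∀ i, MeasurePreserving (fun s : ℝ => s - T i) :=
    fun i => measurePreserving_sub_right volume (T i)
  obtain ⟨w, hwm, hwC, hwW⟩ := exists_concatenation hT (C := C) (W := fun i s => W i (s - T i))
    (fun i => (hWm i).comp_measurePreserving (hshift i))
    (fun i => (hshift i).quasiMeasurePreserving.ae (hWC i))
  -- a curve in `M₀` with velocity `w`
  obtain ⟨g₀, -, hg₀⟩ := hex p (mem_of_mem_nhds hU) 0 (fun s => A' (w s))
    (A'.continuous.comp_aestronglyMeasurable hwm) (by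
      filter_upwards [hwC] with s hs _
      exact A'.le_opNorm_of_le hs)
  set J : Set ℝ := Ioo (-(3 / 4 * δ)) (3 / 4 * δ) with hJ
  -- The curve `g₀` is controlled only on the ball of radius `δ`. Clamping time to a smaller
  -- interval extends it to the line as a Lipschitz curve, unchanged on `J`, which contains all the
  -- `T i`.
  let κ : ℝ → ℝ := fun t => projIcc (-(3 / 4 * δ)) (3 / 4 * δ) (by linarith) t
  have hκ : LipschitzWith 1 κ := LipschitzWith.projIcc _
  have hκmem : ∀ t, κ t ∈ Metric.ball (0 : ℝ) δ := fun t => by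
    have := (projIcc (-(3 / 4 * δ)) (3 / 4 * δ) (by linarith) t).2
    rw [Real.ball_eq_Ioo]
    exact ⟨by linarith [this.1], by linarith [this.2]⟩
  have hf₀l : IsLocallyLipschitz k (g₀ ∘ κ) :=
    isLocallyLipschitz_iff.2 fun t => (hg₀.1 (κ t) (hκmem t)).comp hκ
  have hf₀v : θ₀.HasVelocityOn (fun s => A' (w s)) J (g₀ ∘ κ) := by
    refine (hg₀.mono ?_).congr isOpen_Ioo fun t ht => ?_
    · rw [Real.ball_eq_Ioo]
      exact Ioo_subset_Ioo (by linarith) (by linarith)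
    · have : κ t = t := by
        simp only [κ]
        rw [projIcc_of_mem _ (Ioo_subset_Icc_self ht)]
      rw [Function.comp_apply, this]
  obtain ⟨f₁, hf₁r, hf₁0, hf₁⟩ :=
    hdev (g₀ ∘ κ) (hf₀l.isRectifiable_comp (OrderIso.refl ℝ)) 0 (x 0)
  obtain ⟨h, hh, hv⟩ := hf₁.exists_hasVelocityOn isOpen_Ioo hf₀v
  have hTJ : ∀ i, T i ∈ J := fun i => by
    have h1 : 0 ≤ T i := hT0 ▸ hT.monotone i.zero_le
    exact ⟨by linarith, by linarith [hTlt i]⟩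
  -- On each interval from `T i` to `T (i + 1)`, uniqueness identifies the development with the
  -- shifted joining curve `G i`, both in the parameter `h`.
  have hind : ∀ i, f₁ (T i) = x i := by
    intro i
    induction i with
    | zero => rw [hT0, hf₁0]
    | succ i ih =>
      have hGi : θ.HasVelocityOn (fun s => W i (s - T i)) univ fun s => G i (s - T i) := by
        have hl : LipschitzWith 1 fun s : ℝ => s - T i :=
          LipschitzWith.of_dist_le_mul fun a b => by simp
        refine ((hGv i).comp isOpen_univ hl sub_left_injective).congr_ae ?_
        refine Eventually.of_forall fun s _ => ?_
        simp
      have hGh := hGi.comp isOpen_univ hh h.injective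
      have hlt : h.symm (T i) < h.symm (T (i + 1)) := h.symm.strictMono (hT i.lt_succ_self)
      have key := hv.eqOn_Icc (isOpen_Ioo.preimage h.continuous)
        (ordConnected_Ioo.preimage_mono h.monotone) hlt (by rw [mem_preimage, h.apply_symm_apply]; exact hTJ i)
        (by rw [mem_preimage, h.apply_symm_apply]; exact hTJ (i + 1)) (fun t _ => hGh.1 t (mem_univ _)) (by
          filter_upwards [hGh.2] with s hs hsI
          rw [hs (mem_univ _)]
          have h1 : T i < h s := by simpa using h.strictMono hsI.1
          have h2 : h s < T (i + 1) := by simpa using h.strictMono hsI.2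
          have h3 := hAA' (w (h s))
          simp only [LinearEquiv.coe_coe, h3]
          rw [hwW i (h s) ⟨h1.le, h2⟩]) (by
          simp only [Function.comp_apply, h.apply_symm_apply, ih, sub_self, hG0])
      have := key (right_mem_Icc.2 hlt.le)
      simp only [Function.comp_apply, h.apply_symm_apply, hTs, add_sub_cancel_left, hGτ] at this
      rw [hTs, this]
  have hlim : Tendsto x atTop (𝓝 (f₁ S)) := by
    have := (hf₁r.1.tendsto S).comp hTS
    refine this.congr hind
  refine ⟨f₁ S, ENNReal.tendsto_nhds_zero.2 fun ε hε' => ?_⟩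
  have hε2 : 0 < ε / 2 := ENNReal.half_pos hε'.ne'
  have h1 := hlim.eventually (θ.eventually_edist_lt hB (f₁ S) hε2)
  have h2 : Tendsto (fun i : ℕ => ENNReal.ofReal (δ / 8 * (1 / 2) ^ i)) atTop (𝓝 0) := by
    have := (tendsto_pow_atTop_nhds_zero_of_lt_one (r := (1 / 2 : ℝ)) (by norm_num)
      (by norm_num)).const_mul (δ / 8)
    rw [mul_zero] at this
    simpa using ENNReal.tendsto_ofReal this
  obtain ⟨i, hi1, hi2⟩ := (h1.and (h2.eventually_lt_const hε2)).exists
  -- The Cauchy property carries the limit of the subsequence over to the whole sequence.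
  filter_upwards [eventually_ge_atTop (N i)] with j hj
  calc θ.edist hB (z j) (f₁ S) ≤ θ.edist hB (z j) (x i) + θ.edist hB (x i) (f₁ S) :=
        θ.edist_triangle hB _ _ _
    _ ≤ ε / 2 + ε / 2 := by
        gcongr
        · exact (hN i j hj _ (hφN i)).le.trans hi2.le
        · rw [θ.edist_comm hB]; exact hi1.le
    _ = ε := ENNReal.add_halves ε

end Converse

/-! ### Constant coframings and the equivalences -/

/-- A constant coframing of a manifold all of whose preferred charts agree. -/
noncomputable def Coframing.ofChart {n : ℕ} {M : Type*} [TopologicalSpace M]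
    [ChartedSpace (EuclideanSpace ℝ (Fin n)) M] [IsManifold (𝓡 n) ∞ M]
    {V : Type*} [NormedAddCommGroup V] [NormedSpace ℝ V] (e : EuclideanSpace ℝ (Fin n) ≃L[ℝ] V)
    (hchart : ∀ x y : M, achart (EuclideanSpace ℝ (Fin n)) x = achart (EuclideanSpace ℝ (Fin n)) y) :
    Coframing n M V where
  form _ := (e : EuclideanSpace ℝ (Fin n) →L[ℝ] V)
  bijective _ := e.bijective
  contMDiff := by
    intro x
    refine (contMDiffAt_hom_bundle _).2 ⟨contMDiffAt_id, ?_⟩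
    refine (contMDiffAt_const (c := (e : EuclideanSpace ℝ (Fin n) →L[ℝ] V))).congr_of_eventuallyEq ?_
    refine Eventually.of_forall fun y => ?_
    have hy : y ∈ (chartAt (EuclideanSpace ℝ (Fin n)) x).source := by
      have h : chartAt (EuclideanSpace ℝ (Fin n)) x = chartAt (EuclideanSpace ℝ (Fin n)) y :=
        congrArg Subtype.val (hchart x y)
      exact h ▸ mem_chart_source _ y
    ext1 v
    simp only [ContinuousLinearMap.inCoordinates, ContinuousLinearMap.comp_apply]
    -- With a single chart, the coordinate change goes from that chart to itself and is the
    -- identity.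
    rw [TangentBundle.symmL_trivializationAt_eq_core hy, hchart x y]
    have h1 := (tangentBundleCore (𝓡 n) M).coordChange_self
      (achart (EuclideanSpace ℝ (Fin n)) y) y (mem_chart_source _ y) v
    refine Eq.trans ?_ (congrArg e h1)
    have h2 := Bundle.Trivial.continuousLinearMapAt_trivialization ℝ M V y
    exact DFunLike.congr_fun h2 (e _)
  finrank_eq := by simpa using e.toLinearEquiv.finrank_eq.symm

/-- A lifted copy of `ℝⁿ` provides a model in whichever universe the quantifiers over `M₀` require.
-/
theorem exists_coframing_of_equiv {n : ℕ} {V : Type*} [NormedAddCommGroup V] [NormedSpace ℝ V]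
    (e : EuclideanSpace ℝ (Fin n) ≃L[ℝ] V) :
    ∃ (M₀ : Type*) (_ : TopologicalSpace M₀) (_ : T2Space M₀) (_ : SecondCountableTopology M₀)
      (_ : Nonempty M₀) (_ : ChartedSpace (EuclideanSpace ℝ (Fin n)) M₀)
      (_ : IsManifold (𝓡 n) ∞ M₀), Nonempty (Coframing n M₀ V) := by
  let c := (Homeomorph.ulift (X := EuclideanSpace ℝ (Fin n))).toOpenPartialHomeomorph
  let i := c.singletonChartedSpace rfl
  have hM := c.isManifold_singleton (I := 𝓡 n) (n := ∞) rfl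
  exact ⟨ULift (EuclideanSpace ℝ (Fin n)), inferInstance, inferInstance,
    Homeomorph.ulift.secondCountableTopology, inferInstance, i, hM, ⟨Coframing.ofChart e fun x y => rfl⟩⟩

theorem exists_isInnerProduct (V : Type*) [NormedAddCommGroup V] [NormedSpace ℝ V]
    [FiniteDimensional ℝ V] : ∃ B : V →L[ℝ] V →L[ℝ] ℝ, IsInnerProduct B := by
  have hE : IsInnerProduct (innerSL ℝ (E := EuclideanSpace ℝ (Fin (Module.finrank ℝ V)))) :=
    ⟨fun v w => real_inner_comm w v, fun v hv => real_inner_self_pos.2 hv⟩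
  let e : V ≃L[ℝ] EuclideanSpace ℝ (Fin (Module.finrank ℝ V)) :=
    ContinuousLinearEquiv.ofFinrankEq (by simp)
  exact ⟨_, hE.bilinearComp (L := (e : V →L[ℝ] _)) e.injective⟩

theorem mainTheorem2 {n : ℕ}
    {M : Type*} [TopologicalSpace M] [T2Space M] [SecondCountableTopology M]
    [ChartedSpace (EuclideanSpace ℝ (Fin n)) M] [IsManifold (𝓡 n) ∞ M]
    {V : Type*} [NormedAddCommGroup V] [NormedSpace ℝ V] [FiniteDimensional ℝ V]
    (θ : Coframing n M V) :
    List.TFAE [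
      -- some canonical metric is complete
      ∃ (B : V →L[ℝ] V →L[ℝ] ℝ) (hB : IsInnerProduct B), IsCompleteMetric (θ.canonicalMetric B hB),
      -- every canonical metric is complete
      ∀ (B : V →L[ℝ] V →L[ℝ] ℝ) (hB : IsInnerProduct B), IsCompleteMetric (θ.canonicalMetric B hB),
      -- curves develop from `ℝⁿ`, for some identification of `ℝⁿ` with `V`
      ∃ e : EuclideanSpace ℝ (Fin n) ≃ₗ[ℝ] V,
        CurvesDevelop (standardCoframing n) θ (e : EuclideanSpace ℝ (Fin n) →ₗ[ℝ] V),
      -- curves develop from `ℝⁿ`, for every identification of `ℝⁿ` with `V`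
      ∀ e : EuclideanSpace ℝ (Fin n) ≃ₗ[ℝ] V,
        CurvesDevelop (standardCoframing n) θ (e : EuclideanSpace ℝ (Fin n) →ₗ[ℝ] V),
      -- curves `I`-develop from some manifold with coframing
      ∃ (M₀ : Type*) (_ : TopologicalSpace M₀) (_ : T2Space M₀) (_ : SecondCountableTopology M₀)
        (_ : Nonempty M₀) (_ : ChartedSpace (EuclideanSpace ℝ (Fin n)) M₀)
        (_ : IsManifold (𝓡 n) ∞ M₀) (θ₀ : Coframing n M₀ V),
        CurvesDevelop θ₀ θ LinearMap.id,
      -- curves `A`-develop from any manifold with coframing for any linear map `A`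
      ∀ (k : ℕ) (M₀ : Type*) [TopologicalSpace M₀] [T2Space M₀] [SecondCountableTopology M₀]
        [ChartedSpace (EuclideanSpace ℝ (Fin k)) M₀] [IsManifold (𝓡 k) ∞ M₀]
        (V₀ : Type*) [NormedAddCommGroup V₀] [NormedSpace ℝ V₀] [FiniteDimensional ℝ V₀]
        (θ₀ : Coframing k M₀ V₀) (A : V₀ →ₗ[ℝ] V),
        CurvesDevelop θ₀ θ A] := by
  obtain ⟨B₀, hB₀⟩ := exists_isInnerProduct V
  let e₀ : EuclideanSpace ℝ (Fin n) ≃L[ℝ] V :=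
    ContinuousLinearEquiv.ofFinrankEq (by simp [θ.finrank_eq])
  tfae_have 2 → 1 := fun h => ⟨B₀, hB₀, h B₀ hB₀⟩
  tfae_have 1 → 4 := by
    rintro ⟨B, hB, hc⟩ e
    exact Coframing.curvesDevelop_of_isCompleteMetric _ θ _ hB hc
  tfae_have 4 → 3 := fun h => ⟨e₀.toLinearEquiv, h _⟩
  tfae_have 3 → 2 := by
    rintro ⟨e, he⟩ B hB
    exact CurvesDevelop.isCompleteMetric e he hB
  tfae_have 1 → 5 := by
    rintro ⟨B, hB, hc⟩
    obtain ⟨M₀, i₁, i₂, i₃, i₄, i₅, i₆, ⟨θ₀⟩⟩ := exists_coframing_of_equiv e₀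
    exact ⟨M₀, i₁, i₂, i₃, i₄, i₅, i₆, θ₀,
      Coframing.curvesDevelop_of_isCompleteMetric θ₀ θ _ hB hc⟩
  tfae_have 5 → 2 := by
    rintro ⟨M₀, i₁, i₂, i₃, i₄, i₅, i₆, θ₀, h⟩ B hB
    exact CurvesDevelop.isCompleteMetric (LinearEquiv.refl ℝ V) h hB
  tfae_have 1 → 6 := by
    rintro ⟨B, hB, hc⟩ k M₀ _ _ _ _ _ V₀ _ _ _ θ₀ A
    exact Coframing.curvesDevelop_of_isCompleteMetric θ₀ θ A hB hc
  tfae_have 6 → 2 := by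
    intro h B hB
    -- The universes of `M₀` and `V₀` are prescribed, so the hypothesis is applied to lifted copies
    -- of `ℝⁿ` for both.
    let e₁ : EuclideanSpace ℝ (Fin n) ≃L[ℝ] ULift (EuclideanSpace ℝ (Fin n)) :=
      ContinuousLinearEquiv.ulift.symm
    obtain ⟨M₀, i₁, i₂, i₃, i₄, i₅, i₆, ⟨θ₀⟩⟩ := exists_coframing_of_equiv e₁
    have : FiniteDimensional ℝ (ULift (EuclideanSpace ℝ (Fin n))) :=
      e₁.toLinearEquiv.finiteDimensional
    exact CurvesDevelop.isCompleteMetric (e₁.symm.trans e₀).toLinearEquiv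
      (h n M₀ (ULift (EuclideanSpace ℝ (Fin n))) θ₀ _) hB
  tfae_finish
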